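/- Let $d\ge 0$ and let $\mathcal M_+(\mathbb R^d)$ be the set of finite positive Borel measures on $\mathbb R^d$; write $|E|$ for the Lebesgue measure of a Borel set $E$. For $\mu\in\mathcal M_+(\mathbb R^d)$ and $\alpha\ge 0$ put $$C_\mu(\alpha)=\sup\{\mu(E) : E\subseteq\mathbb R^d \text{ Borel},\ |E|=\alpha\},$$ and write $\mu\preceq\nu$ if $C_\mu(\alpha)\le C_\nu(\alpha)$ for all $\alpha\in[0,\infty)$. Call $\nu\in\mathcal M_+(\mathbb R^d)$ symmetric decreasing if $\nu(dx)=f(x)\,dx+c\,\delta_0(dx)$ for some $c\ge 0$ and some density $f:\mathbb R^d\to[0,\infty]$ such that $f(x)=f(y)$ whenever $|x|=|y|$ and $f(x)\ge f(y)$ whenever $|x|\le|y|$. For $\mu\in\mathcal M_+(\mathbb R^d)$ let $t\mapsto e^{t\Delta}\mu\in\mathcal M_+(\mathbb R^d)$, $t\ge 0$, be the solution of the heat equation $\partial_t u=\Delta u$ with initial condition $e^{0\Delta}\mu=\mu$, that is, for $t>0$, the convolution of $\mu$ with the heat kernel $\Phi_t(x)=(4\pi t)^{-d/2}e^{-|x|^2/(4t)}$.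 Let $\mu,\nu\in\mathcal M_+(\mathbb R^d)$. If $\nu$ is symmetric decreasing and $\mu\preceq\nu$, then $e^{t\Delta}\mu\preceq e^{t\Delta}\nu$ for all $t\ge 0$. -/

import Mathlib

open MeasureTheory Set
open scoped ENNReal NNReal Laplacian ContDiff

noncomputable section

namespace HeatConcentration

/-- The modulus of absolute continuity `C_μ(α) = sup {μ(E) : E Borel, |E| = α}` of a measure
on `ℝᵈ` with respect to Lebesgue measure, as a number in `[0, ∞]`. -/
def modulus {d : ℕ} (μ : FiniteMeasure (EuclideanSpace ℝ (Fin d))) (α : ℝ≥0) : ℝ≥0∞ :=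
  ⨆ (E : Set (EuclideanSpace ℝ (Fin d))) (_ : MeasurableSet E) (_ : volume E = α),
    (μ : Measure (EuclideanSpace ℝ (Fin d))) E

/-- `μ` is less concentrated than `ν`: `C_μ(α) ≤ C_ν(α)` for all `α ∈ [0, ∞)`. -/
def LessConcentrated {d : ℕ} (μ ν : FiniteMeasure (EuclideanSpace ℝ (Fin d))) : Prop :=
  ∀ α : ℝ≥0, modulus μ α ≤ modulus ν α

/-- A density on `ℝᵈ` that is radial and decreasing in the radius. The value `∞` is allowed, so that
densities unbounded near the origin are covered (a density of a finite measure can be `∞` only at the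
origin). -/
def SymmDecreasingFun {d : ℕ} (f : EuclideanSpace ℝ (Fin d) → ℝ≥0∞) : Prop :=
  (∀ x y, ‖x‖ = ‖y‖ → f x = f y) ∧ ∀ x y, ‖x‖ ≤ ‖y‖ → f y ≤ f x

/-- A finite measure of the form `f(x) dx + c δ₀` with a symmetric decreasing density `f ≥ 0`
and `c ≥ 0`. -/
def SymmDecreasing {d : ℕ} (μ : FiniteMeasure (EuclideanSpace ℝ (Fin d))) : Prop :=
  ∃ (f : EuclideanSpace ℝ (Fin d) → ℝ≥0∞) (c : ℝ≥0),
    SymmDecreasingFun f ∧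
      (μ : Measure (EuclideanSpace ℝ (Fin d))) = volume.withDensity f + c • Measure.dirac 0

/-- `u` solves the heat equation `∂ₜ u = Δ u` on `[0, ∞) × ℝᵈ` with initial condition `μ`:
it is a weakly continuous curve of finite positive measures that starts at `μ` and satisfies the
equation in the sense of distributions. -/
structure IsHeatSolution {d : ℕ} (μ : FiniteMeasure (EuclideanSpace ℝ (Fin d)))
    (u : ℝ → FiniteMeasure (EuclideanSpace ℝ (Fin d))) : Prop where
  initial : u 0 = μ
  continuousOn : ContinuousOn u (Ici 0)
  hasDerivAt : ∀ t : ℝ, 0 < t → ∀ φ : EuclideanSpace ℝ (Fin d) → ℝ,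
    ContDiff ℝ ∞ φ → HasCompactSupport φ →
      HasDerivAt (fun s => ∫ x, φ x ∂(u s : Measure (EuclideanSpace ℝ (Fin d))))
        (∫ x, (Δ φ) x ∂(u t : Measure (EuclideanSpace ℝ (Fin d)))) t

/-- The heat kernel `Φₜ(x) = (4πt)^(-d/2) exp(-|x|²/(4t))`, meaningful for `t > 0`. -/
def heatKernel (d : ℕ) (t : ℝ) (x : EuclideanSpace ℝ (Fin d)) : ℝ :=
  (4 * Real.pi * t) ^ (-(d : ℝ) / 2) * Real.exp (-‖x‖ ^ 2 / (4 * t))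

/-- The measure `Φₜ(x) dx` for `t > 0`, and `δ₀` for `t = 0` (and, by convention, `t < 0`). -/
def heatKernelMeasure (d : ℕ) (t : ℝ) : Measure (EuclideanSpace ℝ (Fin d)) :=
  if 0 < t then volume.withDensity (fun x => ENNReal.ofReal (heatKernel d t x))
  else Measure.dirac 0

theorem integrable_heatKernel {d : ℕ} {t : ℝ} (ht : 0 < t) : Integrable (heatKernel d t) := by
  have hb : 0 < ((1 / (4 * t) : ℝ) : ℂ).re := by simp; positivity
  have h := (GaussianFourier.integrable_cexp_neg_mul_sq_norm_add (V := EuclideanSpace ℝ (Fin d))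
    hb 0 0).re
  refine (h.const_mul ((4 * Real.pi * t) ^ (-(d : ℝ) / 2))).congr (.of_forall fun x => ?_)
  simp only [heatKernel]
  congr 1
  have : (-((1 / (4 * t) : ℝ) : ℂ) * (‖x‖ : ℂ) ^ 2 + 0 * (inner ℝ 0 x : ℝ))
      = ((-‖x‖ ^ 2 / (4 * t) : ℝ) : ℂ) := by
    push_cast; ring
  rw [this, ← Complex.ofReal_exp]
  exact Complex.ofReal_re _

theorem heatKernel_nonneg {d : ℕ} {t : ℝ} (ht : 0 < t) (x : EuclideanSpace ℝ (Fin d)) :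
    0 ≤ heatKernel d t x := by
  unfold heatKernel; positivity

theorem measurable_heatKernel (d : ℕ) (t : ℝ) : Measurable (heatKernel d t) := by
  unfold heatKernel; fun_prop

instance instIsFiniteMeasureHeatKernelMeasure (d : ℕ) (t : ℝ) :
    IsFiniteMeasure (heatKernelMeasure d t) := by
  unfold heatKernelMeasure
  split_ifs with ht
  · exact isFiniteMeasure_withDensity_ofReal (integrable_heatKernel ht).2
  · infer_instance

/-- The heat semigroup on finite positive measures, `e^{tΔ} μ = μ ∗ Φₜ` (and `e^{0Δ} μ = μ`).
See `isHeatSolution_iff`: `t ↦ e^{tΔ} μ` is the unique solution of the heat equation on `[0, ∞)`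
with initial condition `μ`. -/
def heatSemigroup {d : ℕ} (t : ℝ) (μ : FiniteMeasure (EuclideanSpace ℝ (Fin d))) :
    FiniteMeasure (EuclideanSpace ℝ (Fin d)) :=
  ⟨(μ : Measure (EuclideanSpace ℝ (Fin d))).conv (heatKernelMeasure d t), inferInstance⟩

theorem charFun_heatKernelMeasure {d : ℕ} {t : ℝ} (ht : 0 ≤ t) (ξ : EuclideanSpace ℝ (Fin d)) :
    charFun (heatKernelMeasure d t) ξ = Complex.exp (-(t * ‖ξ‖ ^ 2 : ℝ)) := by
  rcases ht.eq_or_lt with rfl | ht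
  · simp [heatKernelMeasure, charFun_dirac]
  rw [heatKernelMeasure, if_pos ht, charFun_apply,
    integral_withDensity_eq_integral_toReal_smul (by have := measurable_heatKernel d t; fun_prop)
      (.of_forall fun x => ENNReal.ofReal_lt_top)]
  have hb : 0 < ((1 / (4 * t) : ℝ) : ℂ).re := by simp; positivity
  have h := GaussianFourier.integral_cexp_neg_mul_sq_norm_add (V := EuclideanSpace ℝ (Fin d))
    hb Complex.I ξ
  have e1 : ∀ x : EuclideanSpace ℝ (Fin d),
      (ENNReal.ofReal (heatKernel d t x)).toReal • Complex.exp ((inner ℝ x ξ : ℝ) * Complex.I)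
      = (((4 * Real.pi * t) ^ (-(d : ℝ) / 2) : ℝ) : ℂ) *
        Complex.exp (-((1 / (4 * t) : ℝ) : ℂ) * (‖x‖ : ℂ) ^ 2
          + Complex.I * (inner ℝ ξ x : ℝ)) := by
    intro x
    rw [ENNReal.toReal_ofReal (heatKernel_nonneg ht x), heatKernel, Complex.real_smul,
      Complex.exp_add, real_inner_comm, mul_comm Complex.I]
    push_cast
    rw [mul_assoc]
    congr 3
    ring_nf
  simp_rw [e1]
  rw [integral_const_mul, h, ← mul_assoc]
  have e2 : (Real.pi / ((1 / (4 * t) : ℝ) : ℂ)) = ((4 * Real.pi * t : ℝ) : ℂ) := by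
    push_cast; field_simp
  have e3 : (((4 * Real.pi * t) ^ (-(d : ℝ) / 2) : ℝ) : ℂ) *
      ((4 * Real.pi * t : ℝ) : ℂ) ^ ((Module.finrank ℝ (EuclideanSpace ℝ (Fin d)) : ℂ) / 2) = 1 := by
    have hp : 0 < 4 * Real.pi * t := by positivity
    have : ((Module.finrank ℝ (EuclideanSpace ℝ (Fin d)) : ℂ) / 2) = ((d / 2 : ℝ) : ℂ) := by
      simp
    rw [this, ← Complex.ofReal_cpow hp.le, ← Complex.ofReal_mul, ← Real.rpow_add hp]
    have : -(d : ℝ) / 2 + d / 2 = 0 := by ring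
    simp [this]
  rw [e2, e3, one_mul]
  congr 1
  push_cast
  have : (t : ℂ) ≠ 0 := by exact_mod_cast ht.ne'
  simp only [Complex.I_sq]
  field_simp

theorem charFun_heatSemigroup {d : ℕ} {t : ℝ} (ht : 0 ≤ t)
    (μ : FiniteMeasure (EuclideanSpace ℝ (Fin d))) (ξ : EuclideanSpace ℝ (Fin d)) :
    charFun (heatSemigroup t μ : Measure (EuclideanSpace ℝ (Fin d))) ξ
      = charFun (μ : Measure (EuclideanSpace ℝ (Fin d))) ξ * Complex.exp (-(t * ‖ξ‖ ^ 2 : ℝ)) := by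
  rw [← charFun_heatKernelMeasure ht ξ]
  exact charFun_conv ξ

theorem norm_iteratedFDeriv_comp_clm_le {E F : Type*} [NormedAddCommGroup E] [NormedSpace ℝ E]
    [NormedAddCommGroup F] [NormedSpace ℝ F] (L : E →L[ℝ] F) {f : F → ℝ}
    (hf : ContDiff ℝ ∞ f) (i : ℕ) (x : E) :
    ‖iteratedFDeriv ℝ i (f ∘ L) x‖ ≤ ‖iteratedFDeriv ℝ i f (L x)‖ * ‖L‖ ^ i := by
  rw [L.iteratedFDeriv_comp_right hf x (i := i) (by exact_mod_cast le_top)]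
  refine (ContinuousMultilinearMap.norm_compContinuousLinearMap_le _ _).trans ?_
  simp

theorem abs_laplacian_le {d : ℕ} (f : EuclideanSpace ℝ (Fin d) → ℝ)
    (x : EuclideanSpace ℝ (Fin d)) : |(Δ f) x| ≤ d * ‖iteratedFDeriv ℝ 2 f x‖ := by
  rw [InnerProductSpace.laplacian_eq_iteratedFDeriv_orthonormalBasis f
    (EuclideanSpace.basisFun (Fin d) ℝ)]
  refine (Finset.abs_sum_le_sum_abs _ _).trans ?_
  refine (Finset.sum_le_card_nsmul _ _ ‖iteratedFDeriv ℝ 2 f x‖ fun i _ => ?_).trans (by simp)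
  refine ((iteratedFDeriv ℝ 2 f x).le_opNorm _).trans ?_
  simp [Fin.prod_univ_two]

theorem continuous_laplacian {d : ℕ} {f : EuclideanSpace ℝ (Fin d) → ℝ} (hf : ContDiff ℝ ∞ f) :
    Continuous (Δ f) := by
  rw [InnerProductSpace.laplacian_eq_iteratedFDeriv_orthonormalBasis f
    (EuclideanSpace.basisFun (Fin d) ℝ)]
  have : Continuous (iteratedFDeriv ℝ 2 f) :=
    hf.continuous_iteratedFDeriv (m := 2) (WithTop.coe_le_coe.2 le_top)
  fun_prop

/-- Smooth cutoffs of a function with bounded derivatives. -/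
theorem exists_cutoff {d : ℕ} {g : EuclideanSpace ℝ (Fin d) → ℝ} (hg : ContDiff ℝ ∞ g) {C : ℝ}
    (hC : ∀ i ≤ 2, ∀ x, ‖iteratedFDeriv ℝ i g x‖ ≤ C) :
    ∃ (φ : ℕ → EuclideanSpace ℝ (Fin d) → ℝ) (K : ℝ),
      (∀ n, ContDiff ℝ ∞ (φ n)) ∧ (∀ n, HasCompactSupport (φ n)) ∧
      (∀ n x, |φ n x| ≤ K) ∧ (∀ n x, |(Δ (φ n)) x| ≤ K) ∧
      (∀ x, ∀ᶠ n in Filter.atTop, φ n x = g x ∧ (Δ (φ n)) x = (Δ g) x) := by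
  classical
  obtain ⟨χ⟩ : Nonempty (ContDiffBump (0 : EuclideanSpace ℝ (Fin d))) := inferInstance
  have hχ : ContDiff ℝ ∞ χ := χ.contDiff
  have hχb : ∀ i : ℕ, ∃ B, ∀ x, ‖iteratedFDeriv ℝ i χ x‖ ≤ B := fun i => by
    have hc : HasCompactSupport (iteratedFDeriv ℝ i χ) := χ.hasCompactSupport.iteratedFDeriv i
    exact hc.exists_bound_of_continuous (hχ.continuous_iteratedFDeriv (by exact_mod_cast le_top))
  choose B hB using hχb
  let L : ℕ → EuclideanSpace ℝ (Fin d) →L[ℝ] EuclideanSpace ℝ (Fin d) :=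
    fun n => ((n : ℝ) + 1)⁻¹ • ContinuousLinearMap.id ℝ _
  have hL : ∀ n, ‖L n‖ ≤ 1 := fun n => by
    refine (norm_smul_le ((n : ℝ) + 1)⁻¹ (ContinuousLinearMap.id ℝ (EuclideanSpace ℝ (Fin d)))).trans ?_
    have h1 : ‖((n : ℝ) + 1)⁻¹‖ ≤ 1 := by
      rw [norm_inv]
      apply inv_le_one_of_one_le₀
      rw [Real.norm_of_nonneg (by positivity)]
      have : (0 : ℝ) ≤ n := n.cast_nonneg
      linarith
    have h2 := ContinuousLinearMap.norm_id_le (𝕜 := ℝ) (E := EuclideanSpace ℝ (Fin d))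
    exact mul_le_one₀ h1 (norm_nonneg _) h2
  have hLapp : ∀ n x, L n x = ((n : ℝ) + 1)⁻¹ • x := fun n x => rfl
  have hψ : ∀ n, ContDiff ℝ ∞ (χ ∘ L n) := fun n => hχ.comp (L n).contDiff
  have hψb : ∀ n i x, ‖iteratedFDeriv ℝ i (χ ∘ L n) x‖ ≤ B i := fun n i x => by
    refine (norm_iteratedFDeriv_comp_clm_le (L n) hχ i x).trans ?_
    refine (mul_le_of_le_one_right (norm_nonneg _) (pow_le_one₀ (norm_nonneg _) (hL n))).trans
      (hB i _)
  let φ : ℕ → EuclideanSpace ℝ (Fin d) → ℝ := fun n x => (χ ∘ L n) x * g x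
  have hφ : ∀ n, ContDiff ℝ ∞ (φ n) := fun n => (hψ n).mul hg
  have hφb : ∀ i ≤ 2, ∀ n x, ‖iteratedFDeriv ℝ i (φ n) x‖
      ≤ ∑ j ∈ Finset.range (i + 1), (i.choose j : ℝ) * B j * C := fun i hi n x => by
    refine (norm_iteratedFDeriv_mul_le (hψ n) hg x (n := i) (by exact_mod_cast le_top)).trans ?_
    refine Finset.sum_le_sum fun j hj => ?_
    have hB0 : 0 ≤ B j := (norm_nonneg _).trans (hB j 0)
    have h2 := hC (i - j) (by omega) x
    gcongr
    exact hψb n j x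
  refine ⟨φ, max (∑ j ∈ Finset.range (0 + 1), (Nat.choose 0 j : ℝ) * B j * C)
    (d * ∑ j ∈ Finset.range (2 + 1), (Nat.choose 2 j : ℝ) * B j * C), hφ, fun n => ?_,
    fun n x => ?_, fun n x => ?_, fun x => ?_⟩
  · have hn : ((n : ℝ) + 1)⁻¹ ≠ 0 := by positivity
    have : HasCompactSupport (χ ∘ L n) :=
      χ.hasCompactSupport.comp_homeomorph (Homeomorph.smulOfNeZero _ hn)
    exact this.mul_right
  · refine le_max_of_le_left ?_
    have := hφb 0 (by norm_num) n x
    rwa [norm_iteratedFDeriv_zero] at this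
  · refine le_max_of_le_right ((abs_laplacian_le _ _).trans ?_)
    have := hφb 2 le_rfl n x
    gcongr
  · have ht : Filter.Tendsto (fun n : ℕ => ((n : ℝ) + 1)⁻¹ * (‖x‖ + 1)) Filter.atTop
        (nhds (0 * (‖x‖ + 1))) := by
      refine Filter.Tendsto.mul_const _ ?_
      simpa using tendsto_one_div_add_atTop_nhds_zero_nat (𝕜 := ℝ)
    rw [zero_mul] at ht
    filter_upwards [ht.eventually (gt_mem_nhds χ.rIn_pos)] with n hn
    have hev : φ n =ᶠ[nhds x] g := by
      filter_upwards [Metric.ball_mem_nhds x one_pos] with y hy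
      have hy' : ‖y‖ ≤ ‖x‖ + 1 := by
        have := norm_le_norm_add_norm_sub' y x
        rw [mem_ball_iff_norm] at hy
        linarith
      have h1 : χ (L n y) = 1 := by
        apply χ.one_of_mem_closedBall
        rw [mem_closedBall_zero_iff, hLapp, norm_smul, Real.norm_of_nonneg (by positivity)]
        refine le_trans ?_ hn.le
        gcongr
      simp [φ, h1]
    exact ⟨hev.self_of_nhds, InnerProductSpace.laplacian_congr_nhds hev |>.self_of_nhds⟩

/-- Solutions of the heat equation can be tested against functions with bounded derivatives. -/
theorem IsHeatSolution.integral_sub {d : ℕ} {μ : FiniteMeasure (EuclideanSpace ℝ (Fin d))}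
    {u : ℝ → FiniteMeasure (EuclideanSpace ℝ (Fin d))} (hu : IsHeatSolution μ u)
    {g : EuclideanSpace ℝ (Fin d) → ℝ} (hg : ContDiff ℝ ∞ g) {C : ℝ}
    (hC : ∀ i ≤ 2, ∀ x, ‖iteratedFDeriv ℝ i g x‖ ≤ C) {s t : ℝ} (hs : 0 < s) (hst : s ≤ t) :
    ∫ r in s..t, (∫ x, (Δ g) x ∂(u r : Measure (EuclideanSpace ℝ (Fin d)))) =
      (∫ x, g x ∂(u t : Measure (EuclideanSpace ℝ (Fin d)))) -
        ∫ x, g x ∂(u s : Measure (EuclideanSpace ℝ (Fin d))) := by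
  obtain ⟨φ, K, hφ, hφc, hφK, hφK', hφg⟩ := exists_cutoff hg hC
  have hsub : uIcc s t ⊆ Ici 0 := by
    rw [uIcc_of_le hst]; exact fun r hr => hs.le.trans hr.1
  have hK0 : 0 ≤ K := (abs_nonneg _).trans (hφK 0 0)
  have hcontInt : ∀ f : EuclideanSpace ℝ (Fin d) → ℝ, Continuous f → (∀ x, |f x| ≤ K) →
      ContinuousOn (fun r => ∫ x, f x ∂(u r : Measure (EuclideanSpace ℝ (Fin d)))) (Ici 0) := by
    intro f hf hb r hr
    have := FiniteMeasure.tendsto_iff_forall_integral_tendsto.1 (hu.continuousOn r hr)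
      (BoundedContinuousFunction.ofNormedAddCommGroup f hf K hb)
    exact this
  have hn : ∀ n, ∫ r in s..t, (∫ x, (Δ (φ n)) x ∂(u r : Measure (EuclideanSpace ℝ (Fin d)))) =
      (∫ x, φ n x ∂(u t : Measure (EuclideanSpace ℝ (Fin d)))) -
        ∫ x, φ n x ∂(u s : Measure (EuclideanSpace ℝ (Fin d))) := fun n => by
    refine intervalIntegral.integral_eq_sub_of_hasDerivAt
      (f := fun r => ∫ x, φ n x ∂(u r : Measure (EuclideanSpace ℝ (Fin d))))
      (f' := fun r => ∫ x, (Δ (φ n)) x ∂(u r : Measure (EuclideanSpace ℝ (Fin d))))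
      (fun r hr => ?_) ?_
    · rw [uIcc_of_le hst] at hr
      exact hu.hasDerivAt r (hs.trans_le hr.1) (φ n) (hφ n) (hφc n)
    · exact ((hcontInt _ (continuous_laplacian (hφ n)) (hφK' n)).mono hsub).intervalIntegrable
  have hlim : ∀ r, Filter.Tendsto
      (fun n => ∫ x, φ n x ∂(u r : Measure (EuclideanSpace ℝ (Fin d)))) Filter.atTop
      (nhds (∫ x, g x ∂(u r : Measure (EuclideanSpace ℝ (Fin d))))) := fun r => by
    refine tendsto_integral_of_dominated_convergence (fun _ => K)
      (fun n => (hφ n).continuous.aestronglyMeasurable) (integrable_const K)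
      (fun n => .of_forall (hφK n)) (.of_forall fun x => ?_)
    exact tendsto_const_nhds.congr' ((hφg x).mono fun n h => h.1.symm)
  have hlim' : ∀ r, Filter.Tendsto
      (fun n => ∫ x, (Δ (φ n)) x ∂(u r : Measure (EuclideanSpace ℝ (Fin d)))) Filter.atTop
      (nhds (∫ x, (Δ g) x ∂(u r : Measure (EuclideanSpace ℝ (Fin d))))) := fun r => by
    refine tendsto_integral_of_dominated_convergence (fun _ => K)
      (fun n => (continuous_laplacian (hφ n)).aestronglyMeasurable) (integrable_const K)
      (fun n => .of_forall (hφK' n)) (.of_forall fun x => ?_)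
    exact tendsto_const_nhds.congr' ((hφg x).mono fun n h => h.2.symm)
  have hmass : ContinuousOn (fun r => K * (u r).mass) (Ici 0) := by
    have : ContinuousOn (fun r => (u r).mass) (Ici 0) :=
      FiniteMeasure.continuous_mass.comp_continuousOn hu.continuousOn
    fun_prop
  have hl : Filter.Tendsto
      (fun n => ∫ r in s..t, (∫ x, (Δ (φ n)) x ∂(u r : Measure (EuclideanSpace ℝ (Fin d)))))
      Filter.atTop
      (nhds (∫ r in s..t, (∫ x, (Δ g) x ∂(u r : Measure (EuclideanSpace ℝ (Fin d)))))) := by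
    refine intervalIntegral.tendsto_integral_filter_of_dominated_convergence
      (fun r => K * (u r).mass) (.of_forall fun n => ?_) (.of_forall fun n => ?_)
      (hmass.mono hsub).intervalIntegrable (.of_forall fun r _ => hlim' r)
    · refine ContinuousOn.aestronglyMeasurable ?_ measurableSet_uIoc
      exact (hcontInt _ (continuous_laplacian (hφ n)) (hφK' n)).mono
        (uIoc_subset_uIcc.trans hsub)
    · refine .of_forall fun r _ => ?_
      exact norm_integral_le_of_norm_le_const (.of_forall (hφK' n))
  simp_rw [hn] at hl
  exact tendsto_nhds_unique hl ((hlim t).sub (hlim s))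

theorem IsHeatSolution.integral_eq_exp {d : ℕ} {μ : FiniteMeasure (EuclideanSpace ℝ (Fin d))}
    {u : ℝ → FiniteMeasure (EuclideanSpace ℝ (Fin d))} (hu : IsHeatSolution μ u)
    {g : EuclideanSpace ℝ (Fin d) → ℝ} (hg : ContDiff ℝ ∞ g) {C : ℝ}
    (hC : ∀ i ≤ 2, ∀ x, ‖iteratedFDeriv ℝ i g x‖ ≤ C) {k : ℝ} (hk : ∀ x, (Δ g) x = -k * g x)
    {t : ℝ} (ht : 0 ≤ t) :
    ∫ x, g x ∂(u t : Measure (EuclideanSpace ℝ (Fin d))) =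
      Real.exp (-(t * k)) * ∫ x, g x ∂(μ : Measure (EuclideanSpace ℝ (Fin d))) := by
  set G : ℝ → ℝ := fun r => ∫ x, g x ∂(u r : Measure (EuclideanSpace ℝ (Fin d))) with hG
  have hcont : ContinuousOn G (Ici 0) := by
    intro r hr
    exact FiniteMeasure.tendsto_iff_forall_integral_tendsto.1 (hu.continuousOn r hr)
      (BoundedContinuousFunction.ofNormedAddCommGroup g hg.continuous C
        (fun x => by simpa using hC 0 (by norm_num) x))
  have hint : ∀ s r, 0 < s → s ≤ r → ∫ q in s..r, -k * G q = G r - G s := fun s r hs hsr => by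
    rw [← hu.integral_sub hg hC hs hsr]
    simp_rw [hk, integral_const_mul, hG]
  have hderiv : ∀ r, 0 < r → HasDerivAt G (-k * G r) r := fun r hr => by
    have hc : ContinuousOn (fun q => -k * G q) (Ioi 0) :=
      (hcont.const_smul (-k)).mono Ioi_subset_Ici_self
    have h2 : HasDerivAt (fun v => ∫ q in (r / 2)..v, -k * G q) (-k * G r) r := by
      refine intervalIntegral.integral_hasDerivAt_right ?_ ?_ ?_
      · refine (hc.mono ?_).intervalIntegrable
        rw [uIcc_of_le (by linarith)]
        exact fun q hq => (half_pos hr).trans_le hq.1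
      · exact hc.stronglyMeasurableAtFilter isOpen_Ioi r hr
      · exact hc.continuousAt (Ioi_mem_nhds hr)
    have h3 : G =ᶠ[nhds r] fun v => (∫ q in (r / 2)..v, -k * G q) + G (r / 2) := by
      filter_upwards [Ioi_mem_nhds (half_lt_self hr)] with v hv
      rw [hint _ _ (half_pos hr) (le_of_lt hv)]; ring
    exact (h2.add_const _).congr_of_eventuallyEq h3
  have h : Real.exp (t * k) * G t = Real.exp (0 * k) * G 0 := by
    rcases ht.eq_or_lt with rfl | ht
    · rfl
    have hc : ContinuousOn (fun r => Real.exp (r * k) * G r) (Icc 0 t) :=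
      ContinuousOn.mul (by fun_prop) (hcont.mono Icc_subset_Ici_self)
    obtain ⟨c, -, hc⟩ := exists_hasDerivAt_eq_slope _ (fun _ => 0) ht hc fun r hr => by
      have h1 : HasDerivAt (fun r => Real.exp (r * k)) (Real.exp (r * k) * k) r := by
        simpa using ((hasDerivAt_id r).mul_const k).exp
      refine (h1.mul (hderiv r hr.1)).congr_deriv ?_
      ring
    rw [eq_comm, div_eq_zero_iff] at hc
    rcases hc with hc | hc
    · exact sub_eq_zero.1 hc
    · linarith
  simp only [zero_mul, Real.exp_zero, one_mul] at h
  have hG0 : G 0 = ∫ x, g x ∂(μ : Measure (EuclideanSpace ℝ (Fin d))) := by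
    simp only [hG, hu.initial]
  rw [← hG0, ← h, ← mul_assoc, ← Real.exp_add]
  simp [hG]

theorem laplacian_comp_inner {d : ℕ} (ξ x : EuclideanSpace ℝ (Fin d)) {h : ℝ → ℝ}
    (hh : ContDiff ℝ ∞ h) :
    (Δ (h ∘ innerSL ℝ ξ)) x = ‖ξ‖ ^ 2 * iteratedDeriv 2 h (inner ℝ ξ x) := by
  rw [InnerProductSpace.laplacian_eq_iteratedFDeriv_orthonormalBasis _
    (EuclideanSpace.basisFun (Fin d) ℝ)]
  have hi : ((2 : ℕ) : WithTop ℕ∞) ≤ (∞ : WithTop ℕ∞) := WithTop.coe_le_coe.2 le_top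
  simp_rw [(innerSL ℝ ξ).iteratedFDeriv_comp_right hh x hi]
  simp [iteratedFDeriv_apply_eq_iteratedDeriv_mul_prod, Fin.prod_univ_two, ← Finset.sum_mul,
    pow_two]
  left
  have h := (EuclideanSpace.basisFun (Fin d) ℝ).sum_sq_inner_left ξ
  simpa [pow_two] using h

theorem norm_iteratedFDeriv_comp_inner_le {d : ℕ} (ξ : EuclideanSpace ℝ (Fin d)) {h : ℝ → ℝ}
    (hh : ContDiff ℝ ∞ h) (hb : ∀ i y, |iteratedDeriv i h y| ≤ 1) (i : ℕ) (hi : i ≤ 2)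
    (x : EuclideanSpace ℝ (Fin d)) :
    ‖iteratedFDeriv ℝ i (h ∘ innerSL ℝ ξ) x‖ ≤ max 1 ‖innerSL ℝ ξ‖ ^ 2 := by
  refine (norm_iteratedFDeriv_comp_clm_le _ hh i x).trans ?_
  rw [norm_iteratedFDeriv_eq_norm_iteratedDeriv]
  calc _ ≤ 1 * ‖innerSL ℝ ξ‖ ^ i := by gcongr; exact hb i _
    _ ≤ max 1 ‖innerSL ℝ ξ‖ ^ i := by
      rw [one_mul]; gcongr; exact le_max_right _ _
    _ ≤ _ := pow_le_pow_right₀ (le_max_left _ _) hi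

theorem charFun_eq_cos_add_sin {d : ℕ} (ρ : FiniteMeasure (EuclideanSpace ℝ (Fin d)))
    (ξ : EuclideanSpace ℝ (Fin d)) :
    charFun (ρ : Measure (EuclideanSpace ℝ (Fin d))) ξ =
      ((∫ x, (Real.cos ∘ innerSL ℝ ξ) x ∂(ρ : Measure (EuclideanSpace ℝ (Fin d))) : ℝ) : ℂ) +
      ((∫ x, (Real.sin ∘ innerSL ℝ ξ) x ∂(ρ : Measure (EuclideanSpace ℝ (Fin d))) : ℝ) : ℂ)
        * Complex.I := by
  have hc : Integrable (fun x => (((Real.cos ∘ innerSL ℝ ξ) x : ℝ) : ℂ))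
      (ρ : Measure (EuclideanSpace ℝ (Fin d))) := by
    refine Integrable.of_bound (Continuous.aestronglyMeasurable ?_) 1 (.of_forall fun x => ?_)
    · exact Complex.continuous_ofReal.comp (Real.continuous_cos.comp (innerSL ℝ ξ).continuous)
    · rw [Complex.norm_real]; exact Real.abs_cos_le_one _
  have hs : Integrable (fun x => (((Real.sin ∘ innerSL ℝ ξ) x : ℝ) : ℂ) * Complex.I)
      (ρ : Measure (EuclideanSpace ℝ (Fin d))) := by
    refine Integrable.mul_const ?_ _
    refine Integrable.of_bound (Continuous.aestronglyMeasurable ?_) 1 (.of_forall fun x => ?_)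
    · exact Complex.continuous_ofReal.comp (Real.continuous_sin.comp (innerSL ℝ ξ).continuous)
    · rw [Complex.norm_real]; exact Real.abs_sin_le_one _
  rw [← integral_complex_ofReal, ← integral_complex_ofReal, ← integral_mul_const,
    ← integral_add hc hs, charFun_apply]
  congr 1
  ext x
  rw [Complex.exp_mul_I, real_inner_comm]
  simp

theorem IsHeatSolution.eq_heatSemigroup {d : ℕ}
    {μ : FiniteMeasure (EuclideanSpace ℝ (Fin d))}
    {u : ℝ → FiniteMeasure (EuclideanSpace ℝ (Fin d))} (hu : IsHeatSolution μ u)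
    {t : ℝ} (ht : 0 ≤ t) : u t = heatSemigroup t μ := by
  have : charFun (u t : Measure (EuclideanSpace ℝ (Fin d))) =
      charFun (heatSemigroup t μ : Measure (EuclideanSpace ℝ (Fin d))) := by
    ext ξ
    have hcos := hu.integral_eq_exp (g := Real.cos ∘ innerSL ℝ ξ) (k := ‖ξ‖ ^ 2)
      (Real.contDiff_cos.comp (innerSL ℝ ξ).contDiff)
      (norm_iteratedFDeriv_comp_inner_le ξ Real.contDiff_cos
        fun i y => Real.abs_iteratedDeriv_cos_le_one i y)
      (fun x => by
        rw [laplacian_comp_inner ξ x Real.contDiff_cos]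
        simp [iteratedDeriv_succ]) ht
    have hsin := hu.integral_eq_exp (g := Real.sin ∘ innerSL ℝ ξ) (k := ‖ξ‖ ^ 2)
      (Real.contDiff_sin.comp (innerSL ℝ ξ).contDiff)
      (norm_iteratedFDeriv_comp_inner_le ξ Real.contDiff_sin
        fun i y => Real.abs_iteratedDeriv_sin_le_one i y)
      (fun x => by
        rw [laplacian_comp_inner ξ x Real.contDiff_sin]
        simp [iteratedDeriv_succ]) ht
    rw [charFun_heatSemigroup ht, charFun_eq_cos_add_sin, charFun_eq_cos_add_sin, hcos, hsin]
    push_cast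
    ring
  have e : (u t : Measure (EuclideanSpace ℝ (Fin d))) =
      (heatSemigroup t μ : Measure (EuclideanSpace ℝ (Fin d))) := Measure.ext_of_charFun this
  exact Subtype.ext e

theorem heatKernelMeasure_eq_map {d : ℕ} {t : ℝ} (ht : 0 ≤ t) :
    heatKernelMeasure d t =
      (ProbabilityTheory.stdGaussian (EuclideanSpace ℝ (Fin d))).map (Real.sqrt (2 * t) • ·) := by
  have : IsFiniteMeasure ((ProbabilityTheory.stdGaussian (EuclideanSpace ℝ (Fin d))).map
    (Real.sqrt (2 * t) • ·)) := inferInstance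
  refine Measure.ext_of_charFun (funext fun ξ => ?_)
  rw [charFun_heatKernelMeasure ht, charFun_map_smul, ProbabilityTheory.charFun_stdGaussian,
    norm_smul, Real.norm_of_nonneg (Real.sqrt_nonneg _)]
  congr 1
  norm_cast
  rw [mul_pow, Real.sq_sqrt (by positivity)]
  ring

theorem integral_heatSemigroup {d : ℕ} (μ : FiniteMeasure (EuclideanSpace ℝ (Fin d)))
    {t : ℝ} (ht : 0 ≤ t) {f : EuclideanSpace ℝ (Fin d) → ℝ} (hf : Continuous f) :
    ∫ x, f x ∂(heatSemigroup t μ : Measure (EuclideanSpace ℝ (Fin d))) =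
      ∫ p : EuclideanSpace ℝ (Fin d) × EuclideanSpace ℝ (Fin d),
        f (p.1 + Real.sqrt (2 * t) • p.2)
        ∂((μ : Measure (EuclideanSpace ℝ (Fin d))).prod
          (ProbabilityTheory.stdGaussian (EuclideanSpace ℝ (Fin d)))) := by
  have h1 : (heatSemigroup t μ : Measure (EuclideanSpace ℝ (Fin d))) =
      ((μ : Measure (EuclideanSpace ℝ (Fin d))).prod
        (ProbabilityTheory.stdGaussian (EuclideanSpace ℝ (Fin d)))).map
          (fun p => p.1 + Real.sqrt (2 * t) • p.2) := by
    have h2 : (heatSemigroup t μ : Measure (EuclideanSpace ℝ (Fin d))) =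
      ((μ : Measure (EuclideanSpace ℝ (Fin d))).map id).conv
        (heatKernelMeasure d t) := by rw [Measure.map_id]; rfl
    rw [h2, heatKernelMeasure_eq_map ht, Measure.conv,
      Measure.map_prod_map _ _ (by fun_prop) (by fun_prop),
      Measure.map_map (by fun_prop) (by fun_prop)]
    rfl
  rw [h1, integral_map (by fun_prop) hf.aestronglyMeasurable]

theorem continuousOn_heatSemigroup {d : ℕ} (μ : FiniteMeasure (EuclideanSpace ℝ (Fin d))) :
    ContinuousOn (fun t => heatSemigroup t μ) (Ici 0) := by
  intro t ht
  refine FiniteMeasure.tendsto_iff_forall_integral_tendsto.2 fun f => ?_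
  rw [integral_heatSemigroup μ ht f.continuous]
  have hc : Continuous fun s : ℝ => ∫ p : EuclideanSpace ℝ (Fin d) × EuclideanSpace ℝ (Fin d),
        f (p.1 + Real.sqrt (2 * s) • p.2)
        ∂((μ : Measure (EuclideanSpace ℝ (Fin d))).prod
          (ProbabilityTheory.stdGaussian (EuclideanSpace ℝ (Fin d)))) := by
    refine continuous_of_dominated (bound := fun _ => ‖f‖) (fun s => ?_)
      (fun s => .of_forall fun p => f.norm_coe_le_norm _) (integrable_const _)
      (.of_forall fun p => ?_)
    · exact Continuous.aestronglyMeasurable (by fun_prop)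
    · fun_prop
  refine (hc.tendsto t |>.mono_left nhdsWithin_le_nhds).congr' ?_
  filter_upwards [self_mem_nhdsWithin] with s hs
  rw [integral_heatSemigroup μ hs f.continuous]

open FourierTransform SchwartzMap in
theorem integral_schwartz_eq {d : ℕ} (ρ : FiniteMeasure (EuclideanSpace ℝ (Fin d)))
    (ψ : 𝓢(EuclideanSpace ℝ (Fin d), ℂ)) :
    ∫ x, ψ x ∂(ρ : Measure (EuclideanSpace ℝ (Fin d))) =
      ∫ ξ, (𝓕 ψ) ξ * charFun (ρ : Measure (EuclideanSpace ℝ (Fin d))) ((2 * Real.pi) • ξ) := by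
  have h1 : ∀ x, ψ x = ∫ ξ, (𝓕 ψ) ξ *
      Complex.exp ((inner ℝ x ((2 * Real.pi) • ξ) : ℝ) * Complex.I) := fun x => by
    conv_lhs => rw [← fourierInv_fourier_eq ψ (F := 𝓢(EuclideanSpace ℝ (Fin d), ℂ))]
    rw [SchwartzMap.fourierInv_coe, Real.fourierInv_eq']
    congr 1
    ext ξ
    rw [smul_eq_mul, mul_comm, inner_smul_right, real_inner_comm]
  simp_rw [charFun_apply, ← integral_const_mul]
  rw [← integral_integral_swap]
  · simp_rw [← h1]
  · have hi : Integrable (fun p : EuclideanSpace ℝ (Fin d) × EuclideanSpace ℝ (Fin d) =>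
        (1 : ℂ) * (𝓕 ψ) p.2) ((ρ : Measure (EuclideanSpace ℝ (Fin d))).prod volume) :=
      Integrable.mul_prod (integrable_const _) (𝓕 ψ).integrable
    refine hi.mono (Continuous.aestronglyMeasurable ?_) (.of_forall fun p => ?_)
    · have := (𝓕 ψ).continuous
      simp only [Function.uncurry_def]
      fun_prop
    · simp [Function.uncurry_def, Complex.norm_exp]

open FourierTransform SchwartzMap in
theorem fourier_laplacian_apply {d : ℕ} (ψ : 𝓢(EuclideanSpace ℝ (Fin d), ℂ))
    (ξ : EuclideanSpace ℝ (Fin d)) :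
    (𝓕 (Δ ψ)) ξ = -(((2 * Real.pi) ^ 2 * ‖ξ‖ ^ 2 : ℝ) : ℂ) * (𝓕 ψ) ξ := by
  have h : (fun x : EuclideanSpace ℝ (Fin d) => ‖x‖ ^ 2).HasTemperateGrowth := by fun_prop
  rw [SchwartzMap.laplacian_eq_fourierMultiplierCLM, FourierTransform.fourier_smul,
    fourierMultiplierCLM_apply, fourier_fourierInv_eq, smul_apply]
  erw [smulLeftCLM_apply_apply h]
  simp
  ring

open FourierTransform SchwartzMap in
theorem hasDerivAt_integral_heatSemigroup {d : ℕ}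
    (μ : FiniteMeasure (EuclideanSpace ℝ (Fin d))) (ψ : 𝓢(EuclideanSpace ℝ (Fin d), ℂ))
    {t : ℝ} (ht : 0 < t) :
    HasDerivAt (fun s => ∫ x, ψ x ∂(heatSemigroup s μ : Measure (EuclideanSpace ℝ (Fin d))))
      (∫ x, (Δ ψ) x ∂(heatSemigroup t μ : Measure (EuclideanSpace ℝ (Fin d)))) t := by
  set m : EuclideanSpace ℝ (Fin d) → ℂ :=
    fun ξ => charFun (μ : Measure (EuclideanSpace ℝ (Fin d))) ((2 * Real.pi) • ξ) with hm
  set M : ℝ := (μ : Measure (EuclideanSpace ℝ (Fin d))).real univ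
  have hmeas : AEStronglyMeasurable m volume :=
    (measurable_charFun.comp (measurable_const_smul (2 * Real.pi))).aestronglyMeasurable
  have hmM : ∀ ξ, ‖m ξ‖ ≤ M := fun ξ => norm_charFun_le _
  set q : EuclideanSpace ℝ (Fin d) → ℝ := fun ξ => (2 * Real.pi) ^ 2 * ‖ξ‖ ^ 2 with hq
  have hq0 : ∀ ξ, 0 ≤ q ξ := fun ξ => by positivity
  have hqc : Continuous q := by fun_prop
  have key : ∀ (θ : 𝓢(EuclideanSpace ℝ (Fin d), ℂ)) (s : ℝ), 0 ≤ s →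
      ∫ x, θ x ∂(heatSemigroup s μ : Measure (EuclideanSpace ℝ (Fin d))) =
      ∫ ξ, (𝓕 θ) ξ * (m ξ * Complex.exp (-(s * q ξ : ℝ))) := fun θ s hs => by
    rw [integral_schwartz_eq]
    simp_rw [charFun_heatSemigroup hs]
    congr 1
    ext ξ
    rw [hm, hq, norm_smul, mul_pow, Real.norm_of_nonneg (by positivity)]
  have hexp : ∀ s : ℝ, 0 ≤ s → ∀ ξ, ‖Complex.exp (-(s * q ξ : ℝ))‖ ≤ 1 := fun s hs ξ => by
    rw [← Complex.ofReal_neg, Complex.norm_exp_ofReal]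
    exact Real.exp_le_one_iff.2 (neg_nonpos.2 (mul_nonneg hs (hq0 ξ)))
  have hc := (𝓕 ψ).continuous
  have hmeasF : ∀ s : ℝ, AEStronglyMeasurable
      (fun ξ => (𝓕 ψ) ξ * (m ξ * Complex.exp (-(s * q ξ : ℝ)))) volume := fun s =>
    hc.aestronglyMeasurable.mul (hmeas.mul (Continuous.aestronglyMeasurable (by fun_prop)))
  have hbI : Integrable (fun ξ => (2 * Real.pi) ^ 2 * M * (‖ξ‖ ^ 2 * ‖(𝓕 ψ) ξ‖)) volume :=
    ((𝓕 ψ).integrable_pow_mul volume 2).const_mul _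
  have hd := hasDerivAt_integral_of_dominated_loc_of_deriv_le (μ := volume) (x₀ := t)
    (s := Ioi 0) (F := fun s ξ => (𝓕 ψ) ξ * (m ξ * Complex.exp (-(s * q ξ : ℝ))))
    (F' := fun s ξ => (-(q ξ : ℂ) * (𝓕 ψ) ξ) * (m ξ * Complex.exp (-(s * q ξ : ℝ))))
    (bound := fun ξ => (2 * Real.pi) ^ 2 * M * (‖ξ‖ ^ 2 * ‖(𝓕 ψ) ξ‖))
    (Ioi_mem_nhds ht) (.of_forall hmeasF) ?_ ?_ ?_ hbI ?_
  · have h2 := hd.2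
    rw [key _ t ht.le]
    simp_rw [fourier_laplacian_apply]
    refine h2.congr_of_eventuallyEq ?_
    filter_upwards [Ioi_mem_nhds ht] with s hs
    exact key ψ s (le_of_lt hs)
  · refine ((𝓕 ψ).integrable.norm.mul_const M).mono' (hmeasF t) (.of_forall fun ξ => ?_)
    rw [norm_mul, norm_mul]
    gcongr
    exact (mul_le_of_le_one_right (norm_nonneg _) (hexp t ht.le ξ)).trans (hmM ξ)
  · exact AEStronglyMeasurable.mul (Continuous.aestronglyMeasurable (by fun_prop))
      (hmeas.mul (Continuous.aestronglyMeasurable (by fun_prop)))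
  · refine .of_forall fun ξ s hs => ?_
    rw [norm_mul, norm_mul, norm_mul, norm_neg, Complex.norm_real, Real.norm_of_nonneg (hq0 ξ)]
    calc _ ≤ q ξ * ‖(𝓕 ψ) ξ‖ * M := by
          refine mul_le_mul_of_nonneg_left ?_ (mul_nonneg (hq0 ξ) (norm_nonneg _))
          exact (mul_le_of_le_one_right (norm_nonneg _) (hexp s (le_of_lt hs) ξ)).trans (hmM ξ)
      _ = _ := by rw [hq]; ring
  · refine .of_forall fun ξ s hs => ?_
    have h1 : HasDerivAt (fun s : ℝ => Complex.exp (-(s * q ξ : ℝ)))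
        (Complex.exp (-(s * q ξ : ℝ)) * (-(q ξ : ℂ))) s := by
      have h0 : HasDerivAt (fun s : ℝ => (-(s * q ξ : ℝ) : ℂ)) (-(q ξ : ℂ)) s := by
        have := (((hasDerivAt_id s).mul_const (q ξ)).ofReal_comp).neg
        simp only [one_mul] at this
        exact this
      exact h0.cexp
    refine ((h1.const_mul (m ξ)).const_mul ((𝓕 ψ) ξ)).congr_deriv ?_
    ring

theorem isHeatSolution_heatSemigroup {d : ℕ} (μ : FiniteMeasure (EuclideanSpace ℝ (Fin d))) :
    IsHeatSolution μ (fun t => heatSemigroup t μ) where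
  initial := by
    apply Subtype.ext
    change (μ : Measure (EuclideanSpace ℝ (Fin d))).conv (heatKernelMeasure d 0) = μ
    simp [heatKernelMeasure]
  continuousOn := continuousOn_heatSemigroup μ
  hasDerivAt t ht φ hφ hφc := by
    have hs : ContDiff ℝ ∞ (fun x => (φ x : ℂ)) := Complex.ofRealCLM.contDiff.comp hφ
    have hcs : HasCompactSupport (fun x => (φ x : ℂ)) := hφc.comp_left Complex.ofReal_zero
    have h := hasDerivAt_integral_heatSemigroup μ (hcs.toSchwartzMap hs) ht
    have h1 : ∀ x, hcs.toSchwartzMap hs x = (φ x : ℂ) := fun x => rfl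
    have h2 : ∀ x, (Δ (hcs.toSchwartzMap hs)) x = ((Δ φ) x : ℂ) := fun x => by
      rw [SchwartzMap.laplacian_apply]
      exact (hφ.contDiffAt.of_le (WithTop.coe_le_coe.2 le_top)).laplacian_CLM_comp_left
        (l := Complex.ofRealCLM)
    simp_rw [h1, h2, integral_complex_ofReal] at h
    have h3 := Complex.reCLM.hasFDerivAt.comp_hasDerivAt t h
    exact h3

/-- The curve `t ↦ e^{tΔ} μ` is the unique solution of the heat equation on `[0, ∞)` with initial
condition `μ`. -/
theorem isHeatSolution_iff {d : ℕ} (μ : FiniteMeasure (EuclideanSpace ℝ (Fin d)))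
    (u : ℝ → FiniteMeasure (EuclideanSpace ℝ (Fin d))) :
    IsHeatSolution μ u ↔ ∀ t, 0 ≤ t → u t = heatSemigroup t μ := by
  refine ⟨fun hu t ht => hu.eq_heatSemigroup ht, fun h => ?_⟩
  have hμ := isHeatSolution_heatSemigroup μ
  refine ⟨(h 0 le_rfl).trans hμ.initial, hμ.continuousOn.congr fun t ht => h t ht,
    fun t ht φ hφ hφc => ?_⟩
  rw [h t ht.le]
  refine (hμ.hasDerivAt t ht φ hφ hφc).congr_of_eventuallyEq ?_
  filter_upwards [Ioi_mem_nhds ht] with s hs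
  rw [h s (le_of_lt hs)]

end HeatConcentration

end

/-!
Write `u_E = Φₜ ∗ 1_E` for the heat potential of a Borel set `E` (`potential`), so that
`(e^{tΔ} μ)(E) = ∫ u_E dμ`, and let `D` be a centered set with `|D| = |E|`, a ball about the origin if
`d ≥ 1`. The claim follows from `∫ u_E dμ ≤ ∫ u_D dν` (`lintegral_potential_le_of_lessConcentrated`).

The analytic core is Riesz' rearrangement inequality for two sets and a radially decreasing kernel,
`∫_F u_E ≤ ∫_B u_D` whenever `B` and `D` are centered and at least as large as `F` and `E`
(`interaction_le_interaction_of_isCentered`). It is proved by polarization, without compactness.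
Polarizing `F` and `E` in a hyperplane, towards the side that contains the origin, does not decrease
`∫_F u_E` (`interaction_le_interaction_polarization`) and does not increase the moment of inertia
`∫_E ‖z‖² dz`. For a Gaussian, the amount by which `u_E` fails to be smaller at a farther point `y`
than at a nearer point `x` is bounded by a multiple of the inertia that the polarization of `E` in
the bisector of `x` and `y` removes (`potential_le_add_displaced`): in reflecting `z`, the changes of
`‖z‖²` and of `‖x - z‖² - ‖y - z‖²` are proportional. Hence, among the pairs of sets in a fixed ball that have at
least the given energy, one that nearly minimizes the inertia has a potential that is radially
decreasing up to a small error (`potential_le_add_of_inertia_le`). The bathtub principle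
(`setLIntegral_le_of_isCentered`) then replaces first `F` by `B` and, as `u_B` is exactly radially
decreasing, `E` by `D`.

Applied to `F = {u_E > s}`, Riesz' inequality gives `∫ (u_E - s)₊ ≤ ∫ (u_D - s)₊`, and this yields
`∫₀^∞ min(|{u_E > s}|, |B|) ds ≤ ∫_B u_D` for centered sets `B` (`lintegral_min_volume_le`). If
`ν = f dx + c δ₀`, then `C_ν(α) ≤ ∫₀^∞ min(α, |{f > r}|) dr + c`. By the layer cake formula,
`∫ u_E dμ = ∫₀^∞ μ{u_E > s} ds`, where `μ{u_E > s} ≤ C_ν(|{u_E > s}|)`; inserting the bound for `C_ν`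
and exchanging the integrals gives at most `∫₀^∞ ∫_{f > r} u_D dr + c u_D(0) = ∫ u_D dν`.
-/

namespace HeatConcentration

/-! ### Reflection in the bisecting hyperplane of two points -/

section Reflection

variable {V : Type*} [NormedAddCommGroup V] [InnerProductSpace ℝ V]

/-- The affine function that is positive at the points closer to `y` than to `x`, negative at the
points closer to `x`, and zero on the bisecting hyperplane of `x` and `y`. -/
noncomputable def bisectorSide (x y z : V) : ℝ := inner ℝ (y - x) z - (‖y‖ ^ 2 - ‖x‖ ^ 2) / 2

/-- The reflection in the bisecting hyperplane of `x` and `y` (the identity if `x = y`). -/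
noncomputable def bisectorReflection (x y z : V) : V :=
  z - (2 * bisectorSide x y z / ‖y - x‖ ^ 2) • (y - x)

variable {x y : V}

theorem norm_sub_sq_sub_norm_sub_sq (x y z : V) :
    ‖x - z‖ ^ 2 - ‖y - z‖ ^ 2 = 2 * bisectorSide x y z := by
  rw [bisectorSide, norm_sub_sq_real, norm_sub_sq_real, inner_sub_left]
  ring

theorem bisectorSide_bisectorReflection (h : x ≠ y) (z : V) :
    bisectorSide x y (bisectorReflection x y z) = -bisectorSide x y z := by
  have hn : ‖y - x‖ ≠ 0 := norm_ne_zero_iff.2 (sub_ne_zero.2 h.symm)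
  have e : inner ℝ (y - x) (bisectorReflection x y z)
      = inner ℝ (y - x) z - 2 * bisectorSide x y z := by
    rw [bisectorReflection, inner_sub_right, inner_smul_right, real_inner_self_eq_norm_sq]
    field_simp
  rw [bisectorSide, e, bisectorSide]
  ring

theorem bisectorReflection_bisectorReflection (h : x ≠ y) (z : V) :
    bisectorReflection x y (bisectorReflection x y z) = z := by
  rw [bisectorReflection, bisectorSide_bisectorReflection h, bisectorReflection]
  simp [neg_div]

theorem bisectorReflection_left (h : x ≠ y) : bisectorReflection x y x = y := by
  have hn : ‖y - x‖ ≠ 0 := norm_ne_zero_iff.2 (sub_ne_zero.2 h.symm)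
  have e := norm_sub_sq_sub_norm_sub_sq x y x
  have : 2 * bisectorSide x y x = -‖y - x‖ ^ 2 := by rw [← e]; simp
  rw [bisectorReflection, this, neg_div, div_self (by positivity)]
  simp

theorem norm_sub_bisectorReflection_sq (h : x ≠ y) (v w : V) :
    ‖v - bisectorReflection x y w‖ ^ 2
      = ‖v - w‖ ^ 2 + 4 * bisectorSide x y v * bisectorSide x y w / ‖y - x‖ ^ 2 := by
  have hn : ‖y - x‖ ≠ 0 := norm_ne_zero_iff.2 (sub_ne_zero.2 h.symm)
  have e : v - bisectorReflection x y w
      = (v - w) + (2 * bisectorSide x y w / ‖y - x‖ ^ 2) • (y - x) := by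
    rw [bisectorReflection]; abel
  have e2 : inner ℝ (v - w) (y - x) = bisectorSide x y v - bisectorSide x y w := by
    rw [bisectorSide, bisectorSide, real_inner_comm, inner_sub_right]; ring
  rw [e, norm_add_sq_real, inner_smul_right, e2, norm_smul, mul_pow, Real.norm_eq_abs, sq_abs]
  field_simp
  ring

theorem norm_bisectorReflection_sub (h : x ≠ y) (v w : V) :
    ‖bisectorReflection x y v - bisectorReflection x y w‖ = ‖v - w‖ := by
  rw [← sq_eq_sq₀ (norm_nonneg _) (norm_nonneg _), norm_sub_bisectorReflection_sq h,
    norm_sub_rev, norm_sub_bisectorReflection_sq h, bisectorSide_bisectorReflection h,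
    norm_sub_rev]
  ring

theorem norm_bisectorReflection_sub_comm (h : x ≠ y) (v w : V) :
    ‖bisectorReflection x y v - w‖ = ‖v - bisectorReflection x y w‖ := by
  rw [← norm_bisectorReflection_sub h v, bisectorReflection_bisectorReflection h]

/-- Reflecting `z` in the bisector of `x` and `y` changes `‖z‖ ^ 2` by an amount proportional to
the difference of the squared distances of `z` to `x` and to `y`. -/
theorem norm_sq_sub_norm_bisectorReflection_sq (h : x ≠ y) (z : V) :
    (‖x - z‖ ^ 2 - ‖y - z‖ ^ 2) * (‖y‖ ^ 2 - ‖x‖ ^ 2)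
      = ‖y - x‖ ^ 2 * (‖z‖ ^ 2 - ‖bisectorReflection x y z‖ ^ 2) := by
  have hn : ‖y - x‖ ≠ 0 := norm_ne_zero_iff.2 (sub_ne_zero.2 h.symm)
  have e := norm_sub_bisectorReflection_sq h 0 z
  simp only [zero_sub, norm_neg] at e
  rw [e, norm_sub_sq_sub_norm_sub_sq]
  simp only [bisectorSide, inner_zero_right]
  field_simp
  ring

theorem norm_bisectorReflection_le (h : x ≠ y) (hxy : ‖x‖ ≤ ‖y‖) {z : V}
    (hz : 0 ≤ bisectorSide x y z) : ‖bisectorReflection x y z‖ ≤ ‖z‖ := by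
  have hn : 0 < ‖y - x‖ := norm_pos_iff.2 (sub_ne_zero.2 h.symm)
  have e := norm_sq_sub_norm_bisectorReflection_sq h z
  have h1 : ‖x‖ ^ 2 ≤ ‖y‖ ^ 2 := by gcongr
  rw [norm_sub_sq_sub_norm_sub_sq] at e
  have h2 : 0 ≤ ‖y - x‖ ^ 2 * (‖z‖ ^ 2 - ‖bisectorReflection x y z‖ ^ 2) := by
    rw [← e]; exact mul_nonneg (by linarith) (by linarith)
  have h3 := nonneg_of_mul_nonneg_right h2 (by positivity)
  exact le_of_sq_le_sq (by linarith) (norm_nonneg _)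

theorem continuous_bisectorSide (x y : V) : Continuous (bisectorSide x y) := by
  unfold bisectorSide; fun_prop

theorem continuous_bisectorReflection (x y : V) : Continuous (bisectorReflection x y) := by
  have := continuous_bisectorSide x y
  unfold bisectorReflection; fun_prop

variable [FiniteDimensional ℝ V] [MeasurableSpace V] [BorelSpace V]

theorem measurePreserving_bisectorReflection (h : x ≠ y) :
    MeasurePreserving (bisectorReflection x y) (volume : Measure V) volume := by
  have hn : ‖y - x‖ ≠ 0 := norm_ne_zero_iff.2 (sub_ne_zero.2 h.symm)
  have e : bisectorReflection x y = (fun z => ((‖y‖ ^ 2 - ‖x‖ ^ 2) / ‖y - x‖ ^ 2) • (y - x) + z) ∘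
      (ℝ ∙ (y - x))ᗮ.reflection := by
    ext z
    rw [Function.comp_apply, Submodule.reflection_orthogonal_apply,
      Submodule.reflection_singleton_apply, bisectorReflection, bisectorSide]
    match_scalars
    all_goals try simp
    all_goals field_simp
    all_goals ring
  rw [e]
  exact (measurePreserving_add_left volume _).comp
    (LinearIsometryEquiv.measurePreserving _)

theorem lintegral_comp_bisectorReflection (h : x ≠ y) {f : V → ℝ≥0∞} (hf : Measurable f) :
    ∫⁻ z, f (bisectorReflection x y z) = ∫⁻ z, f z :=
  (measurePreserving_bisectorReflection h).lintegral_comp hf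

end Reflection

/-! ### Polarization of sets -/

section Polarization

variable {V : Type*} [NormedAddCommGroup V] [InnerProductSpace ℝ V]

/-- The part of `E` that polarization moves: the points of `E` on the side of `y` whose mirror image
in the bisector of `x` and `y` does not belong to `E`. -/
def displaced (x y : V) (E : Set V) : Set V :=
  {z | z ∈ E ∧ 0 < bisectorSide x y z ∧ bisectorReflection x y z ∉ E}

/-- The polarization (two-point rearrangement) of `E` towards the side of `x` of the bisector of `x`
and `y`: every point of `E` beyond the bisector whose mirror image is missing from `E` is replaced
by this mirror image. -/
def polarization (x y : V) (E : Set V) : Set V :=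
  (E \ displaced x y E) ∪ bisectorReflection x y ⁻¹' displaced x y E

variable {x y : V}

theorem mem_polarization_iff (h : x ≠ y) (E : Set V) (z : V) :
    z ∈ polarization x y E ↔
      (z ∈ E ∧ (bisectorReflection x y z ∈ E ∨ bisectorSide x y z ≤ 0)) ∨
        (bisectorReflection x y z ∈ E ∧ bisectorSide x y z < 0) := by
  simp only [polarization, displaced, mem_union, mem_sdiff, mem_ofPred_eq, mem_preimage,
    bisectorSide_bisectorReflection h, bisectorReflection_bisectorReflection h]
  by_cases h1 : z ∈ E <;> by_cases h2 : bisectorReflection x y z ∈ E <;>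
    simp [h1, h2]

/-- For a point and its mirror image, polarization moves membership to the side of `x`. -/
theorem mem_polarization_pair (h : x ≠ y) (E : Set V) (z : V) :
    (bisectorSide x y z ≤ 0 →
      (z ∈ polarization x y E ↔ z ∈ E ∨ bisectorReflection x y z ∈ E) ∧
        (bisectorReflection x y z ∈ polarization x y E ↔ z ∈ E ∧ bisectorReflection x y z ∈ E)) ∧
    (0 ≤ bisectorSide x y z →
      (z ∈ polarization x y E ↔ z ∈ E ∧ bisectorReflection x y z ∈ E) ∧
        (bisectorReflection x y z ∈ polarization x y E
          ↔ z ∈ E ∨ bisectorReflection x y z ∈ E)) := by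
  simp only [mem_polarization_iff h, bisectorReflection_bisectorReflection h,
    bisectorSide_bisectorReflection h]
  rcases lt_trichotomy (bisectorSide x y z) 0 with hs | hs | hs
  · simp only [hs, hs.le, hs.not_ge, neg_nonpos, neg_lt_zero, hs.not_gt]
    tauto
  · have : bisectorReflection x y z = z := by simp [bisectorReflection, hs]
    simp [this, hs]
  · simp only [hs, hs.le, hs.not_ge, neg_nonpos, neg_lt_zero, hs.not_gt]
    tauto

theorem displaced_subset (x y : V) (E : Set V) : displaced x y E ⊆ E := fun _ hz => hz.1

theorem disjoint_preimage_displaced (h : x ≠ y) (E : Set V) :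
    Disjoint (E \ displaced x y E) (bisectorReflection x y ⁻¹' displaced x y E) := by
  refine disjoint_left.2 fun z hz hz' => hz'.2.2 ?_
  rw [bisectorReflection_bisectorReflection h]
  exact hz.1

/-- Polarization towards the side containing the origin keeps a set inside a ball about the
origin. -/
theorem polarization_subset_closedBall (h : x ≠ y) (hxy : ‖x‖ ≤ ‖y‖) {E : Set V} {R : ℝ}
    (hE : E ⊆ Metric.closedBall 0 R) : polarization x y E ⊆ Metric.closedBall 0 R := by
  rintro z (hz | hz)
  · exact hE hz.1
  · have h1 := norm_bisectorReflection_le h hxy hz.2.1.le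
    rw [bisectorReflection_bisectorReflection h] at h1
    have h2 := hE hz.1
    rw [mem_closedBall_zero_iff] at h2 ⊢
    exact h1.trans h2

variable [MeasurableSpace V] [BorelSpace V]

theorem measurableSet_displaced (x y : V) {E : Set V} (hE : MeasurableSet E) :
    MeasurableSet (displaced x y E) := by
  refine hE.inter (MeasurableSet.inter ?_ ?_)
  · exact (isOpen_lt continuous_const (continuous_bisectorSide x y)).measurableSet
  · exact ((continuous_bisectorReflection x y).measurable hE).compl

theorem measurableSet_polarization (x y : V) {E : Set V} (hE : MeasurableSet E) :
    MeasurableSet (polarization x y E) :=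
  (hE.diff (measurableSet_displaced x y hE)).union
    ((continuous_bisectorReflection x y).measurable (measurableSet_displaced x y hE))

variable [FiniteDimensional ℝ V]

theorem setLIntegral_polarization (h : x ≠ y) {E : Set V} (hE : MeasurableSet E) {f : V → ℝ≥0∞}
    (hf : Measurable f) :
    ∫⁻ z in polarization x y E, f z = (∫⁻ z in E \ displaced x y E, f z) +
      ∫⁻ z in displaced x y E, f (bisectorReflection x y z) := by
  have hX := measurableSet_displaced x y hE
  have hσ := (continuous_bisectorReflection x y).measurable
  rw [polarization, lintegral_union (hσ hX) (disjoint_preimage_displaced h E)]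
  congr 1
  have e := (measurePreserving_bisectorReflection h).setLIntegral_comp_preimage hX (hf.comp hσ)
  simpa [Function.comp_def, bisectorReflection_bisectorReflection h] using e

theorem volume_polarization (h : x ≠ y) {E : Set V} (hE : MeasurableSet E) :
    volume (polarization x y E) = volume E := by
  have h1 := setLIntegral_polarization h hE (f := fun _ => 1) measurable_const
  rw [setLIntegral_one, setLIntegral_one, setLIntegral_one] at h1
  rw [h1, ← measure_inter_add_sdiff E (measurableSet_displaced x y hE),
    inter_eq_self_of_subset_right (displaced_subset x y E), add_comm]

/-- The potential `y ↦ ∫_E φ(y - z) dz` of the set `E` for the kernel `φ`. -/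
noncomputable def potential (φ : V → ℝ≥0∞) (E : Set V) (y : V) : ℝ≥0∞ := ∫⁻ z in E, φ (y - z)

/-- The interaction energy `∫_F ∫_E φ(y - z) dz dy` of two sets for the kernel `φ`. -/
noncomputable def interaction (φ : V → ℝ≥0∞) (F E : Set V) : ℝ≥0∞ := ∫⁻ y in F, potential φ E y

/-- The polar moment of inertia `∫_E ‖z‖² dz`. -/
noncomputable def inertia (E : Set V) : ℝ≥0∞ := ∫⁻ z in E, ENNReal.ofReal (‖z‖ ^ 2)

theorem measurable_potential {φ : V → ℝ≥0∞} (hφ : Measurable φ) (E : Set V) :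
    Measurable (potential φ E) :=
  Measurable.lintegral_prod_right (hφ.comp measurable_sub)

theorem even_of_radial {W : Type*} [NormedAddCommGroup W] {φ : W → ℝ≥0∞}
    (hφr : ∀ v w, ‖w‖ ≤ ‖v‖ → φ v ≤ φ w) {v w : W}
    (h : ‖v‖ = ‖w‖) : φ v = φ w := (hφr _ _ h.symm.le).antisymm (hφr _ _ h.le)

theorem interaction_comm {φ : V → ℝ≥0∞} (hφ : Measurable φ)
    (hφr : ∀ v w, ‖w‖ ≤ ‖v‖ → φ v ≤ φ w) (F E : Set V) :
    interaction φ F E = interaction φ E F := by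
  unfold interaction potential
  rw [lintegral_lintegral_swap (f := fun y z => φ (y - z)) (hφ.comp measurable_sub).aemeasurable]
  refine lintegral_congr fun z => lintegral_congr fun y => even_of_radial hφr (norm_sub_rev _ _)

/-- The second moment lost under polarization is carried by the displaced set. -/
theorem inertia_polarization_add (h : x ≠ y) (hxy : ‖x‖ ≤ ‖y‖) {E : Set V}
    (hE : MeasurableSet E) :
    inertia (polarization x y E) + ∫⁻ z in displaced x y E,
      ENNReal.ofReal (‖z‖ ^ 2 - ‖bisectorReflection x y z‖ ^ 2) = inertia E := by
  have hX := measurableSet_displaced x y hE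
  have hσ := (continuous_bisectorReflection x y).measurable
  rw [inertia, setLIntegral_polarization h hE (by fun_prop), add_assoc,
    ← lintegral_add_left (by fun_prop), inertia]
  rw [setLIntegral_congr_fun hX (g := fun z => ENNReal.ofReal (‖z‖ ^ 2)), add_comm]
  · rw [← lintegral_inter_add_sdiff _ E hX, inter_eq_self_of_subset_right (displaced_subset x y E)]
  · intro z hz
    have h1 : ‖bisectorReflection x y z‖ ^ 2 ≤ ‖z‖ ^ 2 := by
      have := norm_bisectorReflection_le h hxy hz.2.1.le
      gcongr
    simp only
    rw [← ENNReal.ofReal_add (by positivity) (by linarith)]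
    congr 1; ring

/-- If every point of `P` beyond the bisector of `x` and `y` has its mirror image in `P`, then the
potential of `P` is at least as large at `x` as at `y`. -/
theorem potential_le_of_polarized {φ : V → ℝ≥0∞} (hφ : Measurable φ)
    (hφr : ∀ v w, ‖w‖ ≤ ‖v‖ → φ v ≤ φ w) (h : x ≠ y) {P : Set V} (hP : MeasurableSet P)
    (hPp : ∀ z ∈ P, 0 < bisectorSide x y z → bisectorReflection x y z ∈ P) :
    potential φ P y ≤ potential φ P x := by
  have hσ := (continuous_bisectorReflection x y).measurable
  have key : ∀ v : V, 2 * potential φ P v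
      = ∫⁻ z, P.indicator (fun z => φ (v - z)) z
        + P.indicator (fun z => φ (v - z)) (bisectorReflection x y z) := by
    intro v
    have hm : Measurable (P.indicator fun z => φ (v - z)) :=
      (hφ.comp (measurable_const.sub measurable_id)).indicator hP
    rw [lintegral_add_left hm, lintegral_comp_bisectorReflection h hm, two_mul, potential,
      lintegral_indicator hP]
  have h2 : 2 * potential φ P y ≤ 2 * potential φ P x := by
    rw [key, key]
    refine lintegral_mono fun z => ?_
    -- reflecting `z` exchanges the distances to `x` and to `y`
    have e : ∀ z, φ (x - bisectorReflection x y z) = φ (y - z) := fun z =>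
      even_of_radial hφr (by
        rw [← norm_bisectorReflection_sub_comm h, bisectorReflection_left h])
    have e' : φ (y - bisectorReflection x y z) = φ (x - z) := by
      rw [← e, bisectorReflection_bisectorReflection h]
    have d := norm_sub_sq_sub_norm_sub_sq x y z
    rcases lt_or_ge 0 (bisectorSide x y z) with hs | hs
    · have hle : φ (x - z) ≤ φ (y - z) :=
        hφr _ _ (le_of_sq_le_sq (by linarith) (norm_nonneg _))
      by_cases h1 : z ∈ P
      · have h2 := hPp z h1 hs
        simp [h1, h2, e, e', add_comm]
      · by_cases h2 : bisectorReflection x y z ∈ P <;> simp [h1, h2, e, e', hle]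
    · have hle : φ (y - z) ≤ φ (x - z) :=
        hφr _ _ (le_of_sq_le_sq (by linarith) (norm_nonneg _))
      by_cases h2 : bisectorReflection x y z ∈ P
      · by_cases h1 : z ∈ P
        · simp [h1, h2, e, e', add_comm]
        · rcases hs.eq_or_lt with hs | hs
          · have : bisectorReflection x y z = z := by simp [bisectorReflection, hs]
            exact absurd (this ▸ h2) h1
          · refine absurd ?_ h1
            rw [← bisectorReflection_bisectorReflection h z]
            exact hPp _ h2 (by rw [bisectorSide_bisectorReflection h]; linarith)
      · by_cases h1 : z ∈ P <;> simp [h1, h2, hle]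
  exact (ENNReal.mul_le_mul_iff_right two_ne_zero ENNReal.ofNat_ne_top).1 h2

theorem lintegral_lintegral_reflection_sum {k : V → V → ℝ≥0∞}
    (hk : Measurable (Function.uncurry k)) (h : x ≠ y) :
    4 * ∫⁻ v, ∫⁻ w, k v w = ∫⁻ v, ∫⁻ w, (k v w + k v (bisectorReflection x y w)) +
      (k (bisectorReflection x y v) w
        + k (bisectorReflection x y v) (bisectorReflection x y w)) := by
  have hσ := (continuous_bisectorReflection x y).measurable
  have hkv : ∀ v, Measurable (k v) := fun v => hk.of_uncurry_left
  have e : ∀ v, ∫⁻ w, (k v w + k v (bisectorReflection x y w)) +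
      (k (bisectorReflection x y v) w
        + k (bisectorReflection x y v) (bisectorReflection x y w))
      = 2 * (∫⁻ w, k v w) + 2 * ∫⁻ w, k (bisectorReflection x y v) w := by
    intro v
    have h1 : Measurable fun w => k v (bisectorReflection x y w) := (hkv v).comp hσ
    have h2 : Measurable fun w => k v w + k v (bisectorReflection x y w) := (hkv v).add h1
    rw [lintegral_add_left h2, lintegral_add_left (hkv v),
      lintegral_add_left (hkv _), lintegral_comp_bisectorReflection h (hkv _),
      lintegral_comp_bisectorReflection h (hkv _), two_mul, two_mul]
  have hm : Measurable fun v => ∫⁻ w, k v w := hk.lintegral_prod_right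
  have hm' : Measurable fun v => ∫⁻ w, k (bisectorReflection x y v) w := hm.comp hσ
  simp_rw [e]
  rw [lintegral_add_left (hm.const_mul 2), lintegral_const_mul 2 hm,
    lintegral_const_mul 2 hm', lintegral_comp_bisectorReflection h hm, ← two_mul,
    ← mul_assoc]
  norm_num

/-- Polarizing two sets simultaneously does not decrease their interaction energy. -/
theorem interaction_le_interaction_polarization {φ : V → ℝ≥0∞} (hφ : Measurable φ)
    (hφr : ∀ v w, ‖w‖ ≤ ‖v‖ → φ v ≤ φ w) (h : x ≠ y) {F E : Set V} (hF : MeasurableSet F)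
    (hE : MeasurableSet E) :
    interaction φ F E ≤ interaction φ (polarization x y F) (polarization x y E) := by
  have key : ∀ {F E : Set V}, MeasurableSet F → MeasurableSet E → interaction φ F E
      = ∫⁻ v, ∫⁻ w, F.indicator 1 v * E.indicator 1 w * φ (v - w) := by
    intro F E hF hE
    rw [interaction, ← lintegral_indicator hF]
    refine lintegral_congr fun v => ?_
    by_cases hv : v ∈ F
    · rw [indicator_of_mem hv, potential, ← lintegral_indicator hE]
      refine lintegral_congr fun w => ?_
      by_cases hw : w ∈ E <;> simp [hv, hw]
    · simp [hv]
  have hmeas : ∀ {F E : Set V}, MeasurableSet F → MeasurableSet E → Measurable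
      (Function.uncurry fun v w => F.indicator 1 v * E.indicator 1 w * φ (v - w)) := by
    intro F E hF hE
    have h1 : Measurable (F.indicator (1 : V → ℝ≥0∞)) := measurable_one.indicator hF
    have h2 : Measurable (E.indicator (1 : V → ℝ≥0∞)) := measurable_one.indicator hE
    exact ((h1.comp measurable_fst).mul (h2.comp measurable_snd)).mul (hφ.comp measurable_sub)
  have hF' := measurableSet_polarization x y hF
  have hE' := measurableSet_polarization x y hE
  have h4 : 4 * interaction φ F E
      ≤ 4 * interaction φ (polarization x y F) (polarization x y E) := by
    rw [key hF hE, key hF' hE', lintegral_lintegral_reflection_sum (hmeas hF hE) h,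
      lintegral_lintegral_reflection_sum (hmeas hF' hE') h]
    refine lintegral_mono fun v => lintegral_mono fun w => ?_
    classical
    have e1 : φ (bisectorReflection x y v - bisectorReflection x y w) = φ (v - w) :=
      even_of_radial hφr (norm_bisectorReflection_sub h v w)
    have e2 : φ (bisectorReflection x y v - w) = φ (v - bisectorReflection x y w) :=
      even_of_radial hφr (norm_bisectorReflection_sub_comm h v w)
    have d := norm_sub_bisectorReflection_sq h v w
    have hn : 0 < ‖y - x‖ := norm_pos_iff.2 (sub_ne_zero.2 h.symm)
    -- points on the same side of the bisector are closer to each other than to the mirror images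
    have dle : 0 ≤ bisectorSide x y v * bisectorSide x y w →
        φ (v - bisectorReflection x y w) ≤ φ (v - w) := fun hs => hφr _ _ <| by
      refine le_of_sq_le_sq ?_ (norm_nonneg _)
      have : 0 ≤ 4 * bisectorSide x y v * bisectorSide x y w / ‖y - x‖ ^ 2 := by
        rw [mul_assoc]; positivity
      linarith
    have dge : bisectorSide x y v * bisectorSide x y w ≤ 0 →
        φ (v - w) ≤ φ (v - bisectorReflection x y w) := fun hs => hφr _ _ <| by
      refine le_of_sq_le_sq ?_ (norm_nonneg _)
      have : 4 * bisectorSide x y v * bisectorSide x y w / ‖y - x‖ ^ 2 ≤ 0 := by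
        rw [mul_assoc]
        exact div_nonpos_of_nonpos_of_nonneg (by linarith) (by positivity)
      linarith
    have mF := mem_polarization_pair h F v
    have mE := mem_polarization_pair h E w
    simp only [e1, e2, indicator_apply, Pi.one_apply]
    generalize φ (v - bisectorReflection x y w) = B at *
    generalize φ (v - w) = A at *
    rcases le_total (bisectorSide x y v) 0 with hv | hv <;>
    rcases le_total (bisectorSide x y w) 0 with hw | hw
    · have hAB : B ≤ A := dle (mul_nonneg_of_nonpos_of_nonpos hv hw)
      rw [(mF.1 hv).1, (mF.1 hv).2, (mE.1 hw).1, (mE.1 hw).2]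
      by_cases h1 : v ∈ F <;> by_cases h2 : bisectorReflection x y v ∈ F <;>
      by_cases h3 : w ∈ E <;> by_cases h4 : bisectorReflection x y w ∈ E <;>
      simp [h1, h2, h3, h4, hAB, add_comm]
    · have hAB : A ≤ B := dge (mul_nonpos_of_nonpos_of_nonneg hv hw)
      rw [(mF.1 hv).1, (mF.1 hv).2, (mE.2 hw).1, (mE.2 hw).2]
      by_cases h1 : v ∈ F <;> by_cases h2 : bisectorReflection x y v ∈ F <;>
      by_cases h3 : w ∈ E <;> by_cases h4 : bisectorReflection x y w ∈ E <;>
      simp [h1, h2, h3, h4, hAB, add_comm]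
    · have hAB : A ≤ B := dge (mul_nonpos_of_nonneg_of_nonpos hv hw)
      rw [(mF.2 hv).1, (mF.2 hv).2, (mE.1 hw).1, (mE.1 hw).2]
      by_cases h1 : v ∈ F <;> by_cases h2 : bisectorReflection x y v ∈ F <;>
      by_cases h3 : w ∈ E <;> by_cases h4 : bisectorReflection x y w ∈ E <;>
      simp [h1, h2, h3, h4, hAB, add_comm]
    · have hAB : B ≤ A := dle (mul_nonneg hv hw)
      rw [(mF.2 hv).1, (mF.2 hv).2, (mE.2 hw).1, (mE.2 hw).2]
      by_cases h1 : v ∈ F <;> by_cases h2 : bisectorReflection x y v ∈ F <;>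
      by_cases h3 : w ∈ E <;> by_cases h4 : bisectorReflection x y w ∈ E <;>
      simp [h1, h2, h3, h4, hAB, add_comm]
  exact (ENNReal.mul_le_mul_iff_right (by norm_num) (by norm_num)).1 h4

end Polarization

/-! ### Centered sets and the bathtub principle -/

section Centered

/-- A set is centered if with a point it contains every point of at most the same norm: it is empty,
an open or closed ball about the origin, or the whole space. -/
def IsCentered {W : Type*} [Norm W] (D : Set W) : Prop := ∀ v ∈ D, ∀ w, ‖w‖ ≤ ‖v‖ → w ∈ D

theorem IsCentered.measurableSet {W : Type*} [NormedAddCommGroup W] [MeasurableSpace W]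
    [OpensMeasurableSpace W] {D : Set W} (hD : IsCentered D) : MeasurableSet D := by
  have h1 : D = (fun w => ‖w‖) ⁻¹' {r | ∃ v ∈ D, r ≤ ‖v‖} := by
    ext w
    exact ⟨fun hw => ⟨w, hw, le_rfl⟩, fun ⟨v, hv, hwv⟩ => hD v hv w hwv⟩
  have h2 : OrdConnected {r : ℝ | ∃ v ∈ D, r ≤ ‖v‖} :=
    IsLowerSet.ordConnected fun _ _ hba ⟨v, hv, ha⟩ => ⟨v, hv, hba.trans ha⟩
  rw [h1]
  exact measurable_norm h2.measurableSet

theorem isCentered_closedBall {W : Type*} [NormedAddCommGroup W] (r : ℝ) :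
    IsCentered (Metric.closedBall (0 : W) r) := fun v hv w hwv => by
  rw [mem_closedBall_zero_iff] at hv ⊢
  exact hwv.trans hv

variable {V : Type*} [NormedAddCommGroup V] [InnerProductSpace ℝ V] [FiniteDimensional ℝ V]
  [MeasurableSpace V] [BorelSpace V]

theorem exists_isCentered_volume_eq {E : Set V} (hE : volume E ≠ ⊤) :
    ∃ D : Set V, IsCentered D ∧ volume D = volume E := by
  -- in dimension zero there need not be a ball of the given volume, but every set is centered
  rcases subsingleton_or_nontrivial V with hV | hV
  · refine ⟨E, fun v hv w _ => ?_, rfl⟩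
    rwa [Subsingleton.elim w v]
  set b := (volume (Metric.closedBall (0 : V) 1)).toReal
  set n := Module.finrank ℝ V
  have hn : n ≠ 0 := (Module.finrank_pos (R := ℝ) (M := V)).ne'
  have hb0 : volume (Metric.closedBall (0 : V) 1) ≠ ⊤ := measure_closedBall_lt_top.ne
  have hb : 0 < b := ENNReal.toReal_pos
    (Metric.measure_closedBall_pos volume _ one_pos).ne' hb0
  have hq : 0 ≤ (volume E).toReal / b := by positivity
  refine ⟨Metric.closedBall 0 (((volume E).toReal / b) ^ ((n : ℝ)⁻¹)), isCentered_closedBall _, ?_⟩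
  rw [Measure.addHaar_closedBall' _ _ (Real.rpow_nonneg hq _), Real.rpow_inv_natCast_pow hq hn,
    ← ENNReal.ofReal_toReal hb0, ← ENNReal.ofReal_mul hq, div_mul_cancel₀ _ hb.ne',
    ENNReal.ofReal_toReal hE]

/-- The bathtub principle: if `u` is radially decreasing up to an error `κ`, then its integral over
a set is at most that over a centered set of at least the same volume, up to `κ` times the volume. -/
theorem setLIntegral_le_of_isCentered {u : V → ℝ≥0∞} {κ : ℝ≥0∞} {F D : Set V}
    (hF : MeasurableSet F) (hD : IsCentered D) (hFD : volume F ≤ volume D) (hDf : volume D ≠ ⊤)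
    (hu : ∀ y ∈ F, ∀ x, ‖x‖ ≤ ‖y‖ → u y ≤ u x + κ) :
    ∫⁻ y in F, u y ≤ (∫⁻ y in D, u y) + κ * volume D := by
  have hDm := hD.measurableSet
  have hvol : volume (F \ D) ≤ volume (D \ F) := by
    have h1 := measure_inter_add_sdiff (μ := volume) F hDm
    have h2 := measure_inter_add_sdiff (μ := volume) D hF
    rw [← h1, ← h2, inter_comm D F] at hFD
    refine (ENNReal.add_le_add_iff_left ?_).1 hFD
    exact measure_ne_top_of_subset inter_subset_right hDf
  set m := ⨆ y ∈ F \ D, u y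
  have hm : ∀ x ∈ D \ F, m ≤ u x + κ := fun x hx => by
    refine iSup₂_le fun y hy => hu y hy.1 x ?_
    by_contra! h
    exact hy.2 (hD x hx.1 y h.le)
  have h1 : ∫⁻ y in F \ D, u y ≤ (∫⁻ y in D \ F, u y) + κ * volume D :=
    calc ∫⁻ y in F \ D, u y ≤ ∫⁻ _ in F \ D, m :=
          setLIntegral_mono' (hF.diff hDm) fun y hy => le_iSup₂ (f := fun y _ => u y) y hy
      _ = m * volume (F \ D) := setLIntegral_const _ _
      _ ≤ m * volume (D \ F) := by gcongr
      _ = ∫⁻ _ in D \ F, m := (setLIntegral_const _ _).symm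
      _ ≤ ∫⁻ y in D \ F, (u y + κ) := setLIntegral_mono' (hDm.diff hF) hm
      _ = (∫⁻ y in D \ F, u y) + κ * volume (D \ F) := by
          rw [lintegral_add_right _ measurable_const, setLIntegral_const]
      _ ≤ _ := by gcongr; exact sdiff_subset
  rw [← lintegral_inter_add_sdiff u F hDm, ← lintegral_inter_add_sdiff u D hF, inter_comm D F,
    add_assoc]
  gcongr

theorem potential_le_of_isCentered {φ : V → ℝ≥0∞} (hφ : Measurable φ)
    (hφr : ∀ v w, ‖w‖ ≤ ‖v‖ → φ v ≤ φ w) {D : Set V} (hD : IsCentered D) {x y : V}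
    (hxy : ‖x‖ ≤ ‖y‖) : potential φ D y ≤ potential φ D x := by
  rcases eq_or_ne x y with rfl | h
  · exact le_rfl
  · exact potential_le_of_polarized hφ hφr h hD.measurableSet fun z hz hs =>
      hD z hz _ (norm_bisectorReflection_le h hxy hs.le)

theorem interaction_le_of_isCentered {φ : V → ℝ≥0∞} (hφ : Measurable φ)
    (hφr : ∀ v w, ‖w‖ ≤ ‖v‖ → φ v ≤ φ w) {D E D' : Set V} (hD : IsCentered D)
    (hE : MeasurableSet E) (hD' : IsCentered D') (hED : volume E ≤ volume D')
    (hDf : volume D' ≠ ⊤) : interaction φ D E ≤ interaction φ D D' := by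
  rw [interaction_comm hφ hφr D E, interaction_comm hφ hφr D D']
  have := setLIntegral_le_of_isCentered (u := potential φ D) (κ := 0) hE hD' hED hDf
    fun y _ x hxy => by simpa using potential_le_of_isCentered hφ hφr hD hxy
  rw [zero_mul, add_zero] at this
  exact this

end Centered

/-! ### Riesz' rearrangement inequality -/

section Riesz

variable {V : Type*} [NormedAddCommGroup V] [InnerProductSpace ℝ V] [FiniteDimensional ℝ V]
  [MeasurableSpace V] [BorelSpace V]

/-- The excess of the potential of `E` at a farther point `y` over that at a nearer point `x` is
controlled by the moment of inertia that polarization of `E` would remove. -/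
theorem potential_le_add_displaced {φ : V → ℝ≥0∞} (hφ : Measurable φ)
    (hφr : ∀ v w, ‖w‖ ≤ ‖v‖ → φ v ≤ φ w) {K : ℝ} (hK : 0 ≤ K)
    (hφK : ∀ v w, φ v ≤ φ w + ENNReal.ofReal (K * (‖w‖ ^ 2 - ‖v‖ ^ 2)))
    {x y : V} (hxy : ‖x‖ < ‖y‖) {E : Set V} (hE : MeasurableSet E) {q : ℝ} (hq0 : 0 ≤ q)
    (hq : ‖y - x‖ ^ 2 ≤ q * (‖y‖ ^ 2 - ‖x‖ ^ 2)) :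
    potential φ E y ≤ potential φ E x + ENNReal.ofReal (K * q) * ∫⁻ z in displaced x y E,
      ENNReal.ofReal (‖z‖ ^ 2 - ‖bisectorReflection x y z‖ ^ 2) := by
  have h : x ≠ y := fun h => hxy.ne (by rw [h])
  have hX := measurableSet_displaced x y hE
  have hσ := (continuous_bisectorReflection x y).measurable
  have split : ∀ v, potential φ E v
      = potential φ (displaced x y E) v + potential φ (E \ displaced x y E) v := fun v => by
    rw [potential, ← lintegral_inter_add_sdiff _ E hX,
      inter_eq_self_of_subset_right (displaced_subset x y E)]
    rfl
  have h1 : potential φ (E \ displaced x y E) y ≤ potential φ (E \ displaced x y E) x := by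
    refine potential_le_of_polarized hφ hφr h (hE.diff hX) fun z hz hs => ⟨?_, fun hz' => ?_⟩
    · by_contra hz'
      exact hz.2 ⟨hz.1, hs, hz'⟩
    · have := hz'.2.1
      rw [bisectorSide_bisectorReflection h] at this
      linarith
  have h2 : potential φ (displaced x y E) y ≤ potential φ (displaced x y E) x
      + ENNReal.ofReal (K * q) * ∫⁻ z in displaced x y E,
        ENNReal.ofReal (‖z‖ ^ 2 - ‖bisectorReflection x y z‖ ^ 2) := by
    have hm : Measurable fun z =>
        ENNReal.ofReal (‖z‖ ^ 2 - ‖bisectorReflection x y z‖ ^ 2) := by fun_prop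
    rw [← lintegral_const_mul _ hm, potential, potential,
      ← lintegral_add_right _ (hm.const_mul _)]
    refine setLIntegral_mono' hX fun z hz => (hφK _ (x - z)).trans ?_
    gcongr
    rw [← ENNReal.ofReal_mul (by positivity)]
    refine ENNReal.ofReal_le_ofReal ?_
    have e := norm_sq_sub_norm_bisectorReflection_sq h z
    have hpos : 0 < ‖y‖ ^ 2 - ‖x‖ ^ 2 := by
      have : ‖x‖ ^ 2 < ‖y‖ ^ 2 := by gcongr
      linarith
    have hnn : 0 ≤ ‖z‖ ^ 2 - ‖bisectorReflection x y z‖ ^ 2 := by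
      have := norm_bisectorReflection_le h hxy.le hz.2.1.le
      have : ‖bisectorReflection x y z‖ ^ 2 ≤ ‖z‖ ^ 2 := by gcongr
      linarith
    rw [mul_assoc]
    refine mul_le_mul_of_nonneg_left ?_ hK
    refine le_of_mul_le_mul_right ?_ hpos
    rw [e]
    calc _ ≤ q * (‖y‖ ^ 2 - ‖x‖ ^ 2) * (‖z‖ ^ 2 - ‖bisectorReflection x y z‖ ^ 2) := by gcongr
      _ = _ := by ring
  rw [split, split]
  calc _ ≤ _ := add_le_add h2 h1
    _ = _ := by ring

theorem inertia_le {E : Set V} (hE : MeasurableSet E) {R : ℝ}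
    (hER : E ⊆ Metric.closedBall 0 R) : inertia E ≤ ENNReal.ofReal (R ^ 2) * volume E := by
  rw [← setLIntegral_const]
  refine setLIntegral_mono' hE fun z hz => ENNReal.ofReal_le_ofReal ?_
  have := hER hz
  rw [mem_closedBall_zero_iff] at this
  gcongr

/-- A set in a ball whose moment of inertia cannot be decreased by more than `η ^ 2` by polarization
has a potential that is radially decreasing up to an error proportional to `η`. -/
theorem potential_le_add_of_inertia_le {φ : V → ℝ≥0∞} (hφ : Measurable φ)
    (hφr : ∀ v w, ‖w‖ ≤ ‖v‖ → φ v ≤ φ w) {K : ℝ} (hK : 0 ≤ K)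
    (hφK : ∀ v w, φ v ≤ φ w + ENNReal.ofReal (K * (‖w‖ ^ 2 - ‖v‖ ^ 2)))
    {E : Set V} (hE : MeasurableSet E) {R : ℝ} (hER : E ⊆ Metric.closedBall 0 R)
    {η : ℝ} (hη : 0 < η) (hη1 : η ≤ 1)
    (hJ : ∀ x y : V, ‖x‖ < ‖y‖ →
      inertia E ≤ inertia (polarization x y E) + ENNReal.ofReal (η ^ 2))
    {x y : V} (hyR : ‖y‖ ≤ R) (hxy : ‖x‖ ≤ ‖y‖) :
    potential φ E y ≤ potential φ E x
      + ENNReal.ofReal (K * (5 * R ^ 2) * (volume E).toReal * η + K * 5 * η) := by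
  have hEf : volume E ≠ ⊤ := measure_ne_top_of_subset hER measure_closedBall_lt_top.ne
  have hR : 0 ≤ R := (norm_nonneg y).trans hyR
  rcases eq_or_ne y 0 with rfl | hy0
  · have : x = 0 := by simpa using hxy
    rw [this]; exact le_self_add
  have hy : 0 < ‖y‖ := norm_pos_iff.2 hy0
  -- moving `y` slightly outwards makes the bisector with `x` avoid the origin, quantitatively
  set y' := (1 + η) • y with hy'
  have hny' : ‖y'‖ = (1 + η) * ‖y‖ := by
    rw [hy', norm_smul, Real.norm_of_nonneg (by positivity)]
  have hxy' : ‖x‖ < ‖y'‖ := by rw [hny']; nlinarith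
  have outward_shift : potential φ E y ≤ potential φ E y'
      + ENNReal.ofReal (K * (5 * R ^ 2) * (volume E).toReal * η) := by
    have e : ENNReal.ofReal (K * (5 * R ^ 2) * (volume E).toReal * η)
        = ∫⁻ _ in E, ENNReal.ofReal (K * (5 * R ^ 2 * η)) := by
      rw [setLIntegral_const, ← ENNReal.ofReal_toReal hEf, ← ENNReal.ofReal_mul (by positivity),
        ENNReal.toReal_ofReal (by positivity)]
      congr 1; ring
    rw [e, potential, potential, ← lintegral_add_right _ measurable_const]
    refine setLIntegral_mono' hE fun z hz => (hφK _ (y' - z)).trans ?_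
    gcongr
    have hz' := hER hz
    rw [mem_closedBall_zero_iff] at hz'
    have e2 : y' - z = (y - z) + η • y := by rw [hy', add_smul, one_smul]; abel
    have h3 : ‖y - z‖ ≤ 2 * R := (norm_sub_le _ _).trans (by linarith)
    have h4 : ‖y' - z‖ ≤ ‖y - z‖ + η * R := by
      rw [e2]
      refine (norm_add_le _ _).trans ?_
      rw [norm_smul, Real.norm_of_nonneg hη.le]
      gcongr
    -- `‖y' - z‖ ^ 2 - ‖y - z‖ ^ 2 ≤ 2 * (2 * R) * (η * R) + (η * R) ^ 2 ≤ 5 * R ^ 2 * η`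
    have h5 : ‖y' - z‖ ^ 2 ≤ (‖y - z‖ + η * R) ^ 2 := by gcongr
    have h6 : ‖y - z‖ * (η * R) ≤ 2 * R * (η * R) := by gcongr
    have h7 : η * (η * R ^ 2) ≤ 1 * (η * R ^ 2) := by gcongr
    nlinarith
  -- `‖y' - x‖ ≤ 3 * ‖y‖` while `‖y'‖ ^ 2 - ‖x‖ ^ 2 ≥ 2 * η * ‖y‖ ^ 2`
  have bisector_bound := potential_le_add_displaced hφ hφr hK hφK hxy' hE (q := 9 / (2 * η))
    (by positivity) (by
      have h1 : ‖y' - x‖ ≤ 3 * ‖y‖ := by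
        refine (norm_sub_le _ _).trans ?_
        rw [hny']; nlinarith
      have h2 : ‖y' - x‖ ^ 2 ≤ (3 * ‖y‖) ^ 2 := by gcongr
      have h3 : ‖x‖ ^ 2 ≤ ‖y‖ ^ 2 := by gcongr
      have h4 : 2 * η * ‖y‖ ^ 2 ≤ ‖y'‖ ^ 2 - ‖x‖ ^ 2 := by
        rw [hny']; nlinarith [sq_nonneg (η * ‖y‖)]
      calc _ ≤ (3 * ‖y‖) ^ 2 := h2
        _ = 9 / (2 * η) * (2 * η * ‖y‖ ^ 2) := by field_simp; norm_num
        _ ≤ _ := by gcongr)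
  have gain : ∫⁻ z in displaced x y' E,
      ENNReal.ofReal (‖z‖ ^ 2 - ‖bisectorReflection x y' z‖ ^ 2) ≤ ENNReal.ofReal (η ^ 2) := by
    have h1 := hJ x y' hxy'
    have h2 := inertia_polarization_add (fun h => hxy'.ne (by rw [h])) hxy'.le hE
    rw [← h2] at h1
    refine (ENNReal.add_le_add_iff_left (ne_top_of_le_ne_top ?_ (le_self_add.trans_eq h2))).1 h1
    exact ((inertia_le hE hER).trans_lt (ENNReal.mul_lt_top (by simp) hEf.lt_top)).ne
  calc potential φ E y ≤ _ := outward_shift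
    _ ≤ (potential φ E x + ENNReal.ofReal (K * (9 / (2 * η))) * ENNReal.ofReal (η ^ 2))
        + ENNReal.ofReal (K * (5 * R ^ 2) * (volume E).toReal * η) := by
        gcongr; exact bisector_bound.trans (by gcongr)
    _ ≤ _ := by
        rw [add_assoc, ← ENNReal.ofReal_mul (by positivity),
          ← ENNReal.ofReal_add (by positivity) (by positivity)]
        refine add_le_add_right (ENNReal.ofReal_le_ofReal ?_) _
        have : K * (9 / (2 * η)) * η ^ 2 = K * (9 / 2) * η := by field_simp
        rw [this]
        have : K * (9 / 2) * η ≤ K * 5 * η := by gcongr; norm_num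
        linarith

/-- Riesz' rearrangement inequality for bounded sets. Among the pairs of sets that satisfy the
constraints and have at least the given energy, one whose second set nearly minimizes the moment of
inertia has a nearly radially decreasing potential. -/
theorem interaction_le_of_subset_closedBall {φ : V → ℝ≥0∞} (hφ : Measurable φ)
    (hφr : ∀ v w, ‖w‖ ≤ ‖v‖ → φ v ≤ φ w) {K : ℝ} (hK : 0 ≤ K)
    (hφK : ∀ v w, φ v ≤ φ w + ENNReal.ofReal (K * (‖w‖ ^ 2 - ‖v‖ ^ 2)))
    {F E D D' : Set V} (hF : MeasurableSet F) (hE : MeasurableSet E) {R : ℝ}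
    (hFR : F ⊆ Metric.closedBall 0 R) (hER : E ⊆ Metric.closedBall 0 R)
    (hD : IsCentered D) (hD' : IsCentered D') (hDf : volume D ≠ ⊤) (hDf' : volume D' ≠ ⊤)
    (hFD : volume F ≤ volume D) (hED : volume E ≤ volume D') :
    interaction φ F E ≤ interaction φ D D' := by
  let S : Set (Set V × Set V) := {p | MeasurableSet p.1 ∧ MeasurableSet p.2 ∧
    p.1 ⊆ Metric.closedBall 0 R ∧ p.2 ⊆ Metric.closedBall 0 R ∧ volume p.1 ≤ volume D ∧
    volume p.2 ≤ volume D' ∧ interaction φ F E ≤ interaction φ p.1 p.2}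
  have hS : (F, E) ∈ S := ⟨hF, hE, hFR, hER, hFD, hED, le_rfl⟩
  set j := ⨅ p ∈ S, inertia p.2
  have hj : j ≠ ⊤ := by
    refine ne_top_of_le_ne_top ?_ (iInf₂_le (f := fun (p : Set V × Set V) _ => inertia p.2) _ hS)
    exact ((inertia_le hE hER).trans_lt (ENNReal.mul_lt_top (by simp)
      (hED.trans_lt hDf'.lt_top))).ne
  set C := (K * (5 * R ^ 2) * (volume D').toReal + K * 5) * (volume D).toReal
  have hC : 0 ≤ C := by positivity
  have main : ∀ η : ℝ, 0 < η → η ≤ 1 →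
      interaction φ F E ≤ interaction φ D D' + ENNReal.ofReal (C * η) := by
    intro η hη hη1
    have hlt : j < j + ENNReal.ofReal (η ^ 2) :=
      ENNReal.lt_add_right hj (by simpa using by positivity)
    obtain ⟨⟨F', E'⟩, hp, hlt'⟩ : ∃ p ∈ S, inertia p.2 < j + ENNReal.ofReal (η ^ 2) := by
      simpa only [j, iInf_lt_iff, exists_prop] using hlt
    obtain ⟨hF', hE', hFR', hER', hFD', hED', hI⟩ := hp
    have hJ : ∀ x y : V, ‖x‖ < ‖y‖ →
        inertia E' ≤ inertia (polarization x y E') + ENNReal.ofReal (η ^ 2) := by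
      intro x y hxy
      have h : x ≠ y := fun h => hxy.ne (by rw [h])
      have hmem : (polarization x y F', polarization x y E') ∈ S :=
        ⟨measurableSet_polarization x y hF', measurableSet_polarization x y hE',
          polarization_subset_closedBall h hxy.le hFR',
          polarization_subset_closedBall h hxy.le hER',
          (volume_polarization h hF').trans_le hFD', (volume_polarization h hE').trans_le hED',
          hI.trans (interaction_le_interaction_polarization hφ hφr h hF' hE')⟩
      refine hlt'.le.trans ?_
      gcongr
      exact iInf₂_le (f := fun (p : Set V × Set V) _ => inertia p.2) _ hmem
    set κ := K * (5 * R ^ 2) * (volume E').toReal * η + K * 5 * η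
    have hκ : κ ≤ (K * (5 * R ^ 2) * (volume D').toReal + K * 5) * η := by
      rw [add_mul]
      have : (volume E').toReal ≤ (volume D').toReal := ENNReal.toReal_mono hDf' hED'
      simp only [κ]
      gcongr
    have h1 : interaction φ F' E' ≤ interaction φ D E' + ENNReal.ofReal κ * volume D := by
      refine setLIntegral_le_of_isCentered hF' hD hFD' hDf fun y hy x hxy => ?_
      exact potential_le_add_of_inertia_le hφ hφr hK hφK hE' hER' hη hη1 hJ
        (by simpa using hFR' hy) hxy
    have h2 : ENNReal.ofReal κ * volume D ≤ ENNReal.ofReal (C * η) := by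
      rw [← ENNReal.ofReal_toReal hDf, ← ENNReal.ofReal_mul' ENNReal.toReal_nonneg]
      refine ENNReal.ofReal_le_ofReal ?_
      calc κ * (volume D).toReal ≤ _ := mul_le_mul_of_nonneg_right hκ ENNReal.toReal_nonneg
        _ = C * η := by simp only [C]; ring
    exact hI.trans (h1.trans (add_le_add
      (interaction_le_of_isCentered hφ hφr hD hE' hD' hED' hDf') h2))
  refine ENNReal.le_of_forall_pos_le_add fun ε hε _ => ?_
  have hη : 0 < min 1 ((ε : ℝ) / (C + 1)) := by positivity
  refine (main _ hη (min_le_left _ _)).trans ?_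
  gcongr
  rw [← ENNReal.ofReal_coe_nnreal]
  refine ENNReal.ofReal_le_ofReal ?_
  calc C * min 1 ((ε : ℝ) / (C + 1)) ≤ (C + 1) * (ε / (C + 1)) := by
        gcongr
        · linarith
        · exact min_le_right _ _
    _ = ε := by field_simp

/-- Riesz' rearrangement inequality for two sets and a radially decreasing kernel. -/
theorem interaction_le_interaction_of_isCentered {φ : V → ℝ≥0∞} (hφ : Measurable φ)
    (hφr : ∀ v w, ‖w‖ ≤ ‖v‖ → φ v ≤ φ w) {K : ℝ} (hK : 0 ≤ K)
    (hφK : ∀ v w, φ v ≤ φ w + ENNReal.ofReal (K * (‖w‖ ^ 2 - ‖v‖ ^ 2)))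
    {F E D D' : Set V} (hF : MeasurableSet F) (hE : MeasurableSet E)
    (hD : IsCentered D) (hD' : IsCentered D') (hDf : volume D ≠ ⊤) (hDf' : volume D' ≠ ⊤)
    (hFD : volume F ≤ volume D) (hED : volume E ≤ volume D') :
    interaction φ F E ≤ interaction φ D D' := by
  have hmono : ∀ A : Set V, Monotone fun n : ℕ => A ∩ Metric.closedBall 0 n := fun A m n hmn =>
    inter_subset_inter_right _ (Metric.closedBall_subset_closedBall (by exact_mod_cast hmn))
  have hU : ∀ A : Set V, ⋃ n : ℕ, A ∩ Metric.closedBall 0 n = A := fun A => by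
    rw [← inter_iUnion, Metric.iUnion_closedBall_nat, inter_univ]
  have hpot : ∀ y, potential φ E y = ⨆ n : ℕ, potential φ (E ∩ Metric.closedBall 0 n) y :=
    fun y => by
      conv_lhs => rw [potential, ← hU E]
      exact setLIntegral_iUnion_of_directed _ (hmono E).directed_le
  have h1 : interaction φ F E = ⨆ n : ℕ, interaction φ F (E ∩ Metric.closedBall 0 n) := by
    simp_rw [interaction, hpot]
    refine lintegral_iSup (fun n => measurable_potential hφ _) fun m n hmn y => ?_
    exact lintegral_mono_set (hmono E hmn)
  have h2 : ∀ A, interaction φ F A = ⨆ n : ℕ, interaction φ (F ∩ Metric.closedBall 0 n) A :=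
    fun A => by
      conv_lhs => rw [interaction, ← hU F]
      exact setLIntegral_iUnion_of_directed _ (hmono F).directed_le
  rw [h1]
  refine iSup_le fun n => ?_
  rw [h2]
  refine iSup_le fun m => ?_
  have hsub : ∀ (A : Set V) (i k : ℕ), i ≤ k → A ∩ Metric.closedBall 0 i
      ⊆ Metric.closedBall 0 (k : ℝ) := fun A i k hik =>
    inter_subset_right.trans (Metric.closedBall_subset_closedBall (by exact_mod_cast hik))
  exact interaction_le_of_subset_closedBall hφ hφr hK hφK
    (hF.inter Metric.isClosed_closedBall.measurableSet)
    (hE.inter Metric.isClosed_closedBall.measurableSet)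
    (hsub F m (max m n) (le_max_left _ _)) (hsub E n (max m n) (le_max_right _ _)) hD hD' hDf hDf'
    ((measure_mono inter_subset_left).trans hFD) ((measure_mono inter_subset_left).trans hED)

end Riesz

/-! ### The layer cake formula -/

section LayerCake

theorem volume_Ioi_inter_ofReal_lt (a : ℝ≥0∞) :
    volume (Ioi (0 : ℝ) ∩ {s : ℝ | ENNReal.ofReal s < a}) = a := by
  rcases eq_or_ne a ⊤ with rfl | ha
  · simp
  · have : Ioi (0 : ℝ) ∩ {s : ℝ | ENNReal.ofReal s < a} = Ioo 0 a.toReal := by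
      ext s
      simp only [mem_inter_iff, mem_Ioi, mem_ofPred_eq, mem_Ioo, and_congr_right_iff]
      exact fun hs => ENNReal.ofReal_lt_iff_lt_toReal hs.le ha
    rw [this, Real.volume_Ioo, sub_zero, ENNReal.ofReal_toReal ha]

/-- The layer cake formula for functions with values in `[0, ∞]`. -/
theorem lintegral_eq_lintegral_Ioi_measure_lt {α : Type*} [MeasurableSpace α] (μ : Measure α)
    [SFinite μ] {f : α → ℝ≥0∞} (hf : Measurable f) :
    ∫⁻ x, f x ∂μ = ∫⁻ s in Ioi (0 : ℝ), μ {x | ENNReal.ofReal s < f x} := by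
  have hm : MeasurableSet {p : α × ℝ | ENNReal.ofReal p.2 < f p.1} :=
    measurableSet_lt (by fun_prop) (by fun_prop)
  have h1 := Measure.prod_apply (μ := μ) (ν := volume.restrict (Ioi (0 : ℝ))) hm
  have h2 := Measure.prod_apply_symm (μ := μ) (ν := volume.restrict (Ioi (0 : ℝ))) hm
  rw [h1] at h2
  simp only [preimage_ofPred_eq] at h2
  rw [← h2]
  refine lintegral_congr fun x => ?_
  rw [Measure.restrict_apply (measurableSet_lt (by fun_prop) measurable_const), inter_comm]
  exact (volume_Ioi_inter_ofReal_lt _).symm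

/-- Splitting the layers at height `s`. -/
theorem lintegral_Ioi_min_measure_le {α : Type*} [MeasurableSpace α] (μ : Measure α)
    [SFinite μ] {g : α → ℝ≥0∞} (hg : Measurable g) (β : ℝ≥0∞) {s : ℝ} (hs : 0 ≤ s) :
    ∫⁻ r in Ioi (0 : ℝ), min (μ {x | ENNReal.ofReal r < g x}) β
      ≤ ENNReal.ofReal s * β + ∫⁻ x, (g x - ENNReal.ofReal s) ∂μ := by
  rw [← Ioc_union_Ioi_eq_Ioi hs, lintegral_union measurableSet_Ioi (Ioc_disjoint_Ioi le_rfl)]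
  refine add_le_add ?_ ?_
  · calc _ ≤ ∫⁻ _ in Ioc 0 s, β := lintegral_mono fun r => min_le_right _ _
      _ = _ := by rw [setLIntegral_const, Real.volume_Ioc, sub_zero, mul_comm]
  · rw [lintegral_eq_lintegral_Ioi_measure_lt μ (hg.sub_const _)]
    have e := (measurePreserving_add_right volume s).setLIntegral_comp_preimage_emb
      (measurableEmbedding_addRight s) (fun r => μ {x | ENNReal.ofReal r < g x}) (Ioi s)
    have e2 : (fun r => r + s) ⁻¹' Ioi s = Ioi 0 := by ext r; simp
    rw [e2] at e
    calc _ ≤ ∫⁻ r in Ioi s, μ {x | ENNReal.ofReal r < g x} :=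
          lintegral_mono fun r => min_le_left _ _
      _ = _ := e.symm
      _ = _ := by
          refine setLIntegral_congr_fun measurableSet_Ioi fun r hr => ?_
          congr 1
          ext x
          rw [mem_ofPred_eq, mem_ofPred_eq, ENNReal.ofReal_add (le_of_lt hr) hs, lt_tsub_iff_right]

theorem measure_lt_ne_top_of_lintegral_ne_top {α : Type*} [MeasurableSpace α] {μ : Measure α}
    {g : α → ℝ≥0∞} (hg : Measurable g) (hgi : ∫⁻ x, g x ∂μ ≠ ⊤) {s : ℝ≥0∞} (hs0 : s ≠ 0)
    (hs : s ≠ ⊤) : μ {x | s < g x} ≠ ⊤ := by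
  have hle : {x | s < g x} ⊆ {x | s ≤ g x} := fun x hx => le_of_lt (mem_ofPred_eq ▸ hx)
  exact ne_top_of_le_ne_top (ENNReal.div_ne_top hgi hs0)
    ((measure_mono hle).trans (meas_ge_le_lintegral_div hg.aemeasurable hs0 hs))

end LayerCake

/-! ### Rearrangement of potentials -/

section Concentration

variable {V : Type*} [NormedAddCommGroup V] [InnerProductSpace ℝ V] [FiniteDimensional ℝ V]
  [MeasurableSpace V] [BorelSpace V]

theorem potential_le_lintegral (φ : V → ℝ≥0∞) (E : Set V) (y : V) :
    potential φ E y ≤ ∫⁻ z, φ z :=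
  (setLIntegral_le_lintegral _ _).trans (lintegral_sub_left_eq_self φ y).le

theorem lintegral_potential {φ : V → ℝ≥0∞} (hφ : Measurable φ) (E : Set V) :
    ∫⁻ y, potential φ E y = (∫⁻ z, φ z) * volume E := by
  unfold potential
  rw [lintegral_lintegral_swap (f := fun y z => φ (y - z)) (hφ.comp measurable_sub).aemeasurable,
    ← setLIntegral_const]
  exact lintegral_congr fun z => lintegral_sub_right_eq_self φ z

/-- Rearranging a set increases the supremum of its potential. -/
theorem potential_le_potential_zero {φ : V → ℝ≥0∞} (hφr : ∀ v w, ‖w‖ ≤ ‖v‖ → φ v ≤ φ w)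
    {E D : Set V} (hE : MeasurableSet E) (hD : IsCentered D) (hDf : volume D ≠ ⊤)
    (hED : volume E ≤ volume D) (y : V) : potential φ E y ≤ potential φ D 0 := by
  have hmp : MeasurePreserving (fun z : V => y - z) volume volume :=
    Measure.measurePreserving_sub_left volume y
  have hEm : MeasurableSet ((fun z : V => y - z) ⁻¹' E) := hmp.measurable hE
  have h1 : potential φ E y = ∫⁻ z in (fun z : V => y - z) ⁻¹' E, φ z := by
    have e := hmp.setLIntegral_comp_preimage_emb (Homeomorph.subLeft y).measurableEmbedding
      (fun z => φ (y - z)) E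
    rw [potential, ← e]
    simp
  have h2 : potential φ D 0 = ∫⁻ z in D, φ z := by
    refine lintegral_congr fun z => even_of_radial hφr (by simp)
  rw [h1, h2]
  have := setLIntegral_le_of_isCentered (u := φ) (κ := 0) hEm hD
    (by rwa [hmp.measure_preimage hE.nullMeasurableSet]) hDf
    fun v _ w hwv => by simpa using hφr v w hwv
  simpa only [zero_mul, add_zero] using this

/-- Rearranging a set increases the integral of every positive part `(u - s)₊` of its potential
`u`. -/
theorem lintegral_potential_sub_le {φ : V → ℝ≥0∞} (hφ : Measurable φ)
    (hφr : ∀ v w, ‖w‖ ≤ ‖v‖ → φ v ≤ φ w) (hφi : ∫⁻ z, φ z ≠ ⊤) {K : ℝ} (hK : 0 ≤ K)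
    (hφK : ∀ v w, φ v ≤ φ w + ENNReal.ofReal (K * (‖w‖ ^ 2 - ‖v‖ ^ 2)))
    {E D : Set V} (hE : MeasurableSet E) (hD : IsCentered D) (hDf : volume D ≠ ⊤)
    (hED : volume E ≤ volume D) {s : ℝ≥0∞} (hs0 : s ≠ 0) (hs : s ≠ ⊤) :
    ∫⁻ x, (potential φ E x - s) ≤ ∫⁻ x, (potential φ D x - s) := by
  have hm := measurable_potential hφ E
  set F := {x | s < potential φ E x}
  have hF : MeasurableSet F := measurableSet_lt measurable_const hm
  have hEi : ∫⁻ x, potential φ E x ≠ ⊤ := by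
    rw [lintegral_potential hφ]
    exact ENNReal.mul_ne_top hφi (ne_top_of_le_ne_top hDf hED)
  have hFf : volume F ≠ ⊤ := measure_lt_ne_top_of_lintegral_ne_top hm hEi hs0 hs
  obtain ⟨B, hB, hBF⟩ := exists_isCentered_volume_eq hFf
  have h1 : ∫⁻ x, (potential φ E x - s) = ∫⁻ x in F, (potential φ E x - s) := by
    rw [← lintegral_indicator hF]
    refine lintegral_congr fun x => ?_
    by_cases hx : x ∈ F
    · simp [hx]
    · rw [indicator_of_notMem hx]
      exact tsub_eq_zero_of_le (not_lt.1 hx)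
  have h2 : (∫⁻ x in F, (potential φ E x - s)) + s * volume F = interaction φ F E := by
    rw [← setLIntegral_const, ← lintegral_add_right _ measurable_const]
    exact setLIntegral_congr_fun hF fun x hx => tsub_add_cancel_of_le (le_of_lt hx)
  have h3 : interaction φ B D ≤ (∫⁻ x, (potential φ D x - s)) + s * volume F := by
    calc interaction φ B D ≤ ∫⁻ x in B, ((potential φ D x - s) + s) :=
          lintegral_mono fun x => le_tsub_add
      _ = (∫⁻ x in B, (potential φ D x - s)) + s * volume B := by
          rw [lintegral_add_right _ measurable_const, setLIntegral_const]
      _ ≤ _ := by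
          rw [hBF]; exact add_le_add_left (setLIntegral_le_lintegral _ _) _
  have h4 := interaction_le_interaction_of_isCentered hφ hφr hK hφK hF hE hB hD (hBF ▸ hFf) hDf
    hBF.ge hED
  rw [h1]
  refine (ENNReal.add_le_add_iff_right (ENNReal.mul_ne_top hs hFf)).1 ?_
  exact h2.trans_le (h4.trans h3)

/-- The integrated form of Riesz' inequality: the left side is the supremum of the integrals of the
potential of `E` over sets of the volume of `B`. -/
theorem lintegral_min_volume_le {φ : V → ℝ≥0∞} (hφ : Measurable φ)
    (hφr : ∀ v w, ‖w‖ ≤ ‖v‖ → φ v ≤ φ w) (hφi : ∫⁻ z, φ z ≠ ⊤) {K : ℝ} (hK : 0 ≤ K)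
    (hφK : ∀ v w, φ v ≤ φ w + ENNReal.ofReal (K * (‖w‖ ^ 2 - ‖v‖ ^ 2)))
    {E D B : Set V} (hE : MeasurableSet E) (hD : IsCentered D) (hDf : volume D ≠ ⊤)
    (hED : volume E ≤ volume D) (hB : IsCentered B) (hBf : volume B ≠ ⊤) :
    ∫⁻ r in Ioi (0 : ℝ), min (volume {x | ENNReal.ofReal r < potential φ E x}) (volume B)
      ≤ ∫⁻ x in B, potential φ D x := by
  -- the level `s` separates the values of the potential of `D` inside `B` from those outside
  set s := ⨆ y ∈ Bᶜ, potential φ D y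
  have hsB : ∀ x ∈ B, s ≤ potential φ D x := fun x hx => iSup₂_le fun y hy =>
    potential_le_of_isCentered hφ hφr hD <| by
      by_contra! h
      exact hy (hB x hx y h.le)
  have hs : s ≠ ⊤ := ne_top_of_le_ne_top hφi (iSup₂_le fun y _ => potential_le_lintegral φ D y)
  -- a level slightly above `s` is positive, so that the superlevel sets have finite volume
  refine ENNReal.le_of_forall_pos_le_add fun ε hε _ => ?_
  obtain ⟨δ, hδ, hδε⟩ : ∃ δ : ℝ≥0, 0 < δ ∧ δ * volume B ≤ ε := by
    refine ⟨ε / ((volume B).toNNReal + 1), by positivity, ?_⟩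
    rw [← ENNReal.coe_toNNReal hBf, ← ENNReal.coe_mul, ENNReal.coe_le_coe, ENNReal.toNNReal_coe,
      div_mul_eq_mul_div]
    refine NNReal.div_le_of_le_mul ?_
    gcongr
    exact le_self_add
  set s' : ℝ≥0∞ := s + δ
  have hs' : s' ≠ ⊤ := ENNReal.add_ne_top.2 ⟨hs, ENNReal.coe_ne_top⟩
  have hs0 : s' ≠ 0 := by
    simp only [s', ne_eq, add_eq_zero, ENNReal.coe_eq_zero, not_and]
    exact fun _ => hδ.ne'
  have hBm := hB.measurableSet
  have h1 : ∫⁻ x, (potential φ D x - s') = ∫⁻ x in B, (potential φ D x - s') := by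
    rw [← lintegral_indicator hBm]
    refine lintegral_congr fun x => ?_
    by_cases hx : x ∈ B
    · simp [hx]
    · rw [indicator_of_notMem hx]
      refine tsub_eq_zero_of_le (le_trans ?_ le_self_add)
      exact le_iSup₂ (f := fun y (_ : y ∈ Bᶜ) => potential φ D y) x hx
  calc _ ≤ ENNReal.ofReal s'.toReal * volume B
        + ∫⁻ x, (potential φ E x - ENNReal.ofReal s'.toReal) :=
        lintegral_Ioi_min_measure_le volume (measurable_potential hφ E) _ ENNReal.toReal_nonneg
    _ ≤ s' * volume B + ∫⁻ x in B, (potential φ D x - s') := by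
        rw [ENNReal.ofReal_toReal hs', ← h1]
        exact add_le_add_right
          (lintegral_potential_sub_le hφ hφr hφi hK hφK hE hD hDf hED hs0 hs') _
    _ = ∫⁻ x in B, (s' + (potential φ D x - s')) := by
        rw [lintegral_add_left measurable_const, setLIntegral_const]
    _ ≤ ∫⁻ x in B, (potential φ D x + δ) := by
        refine setLIntegral_mono' hBm fun x hx => ?_
        rw [add_tsub_eq_max]
        exact max_le (by simp only [s']; gcongr; exact hsB x hx) le_self_add
    _ = (∫⁻ x in B, potential φ D x) + δ * volume B := by
        rw [lintegral_add_right _ measurable_const, setLIntegral_const]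
    _ ≤ _ := by gcongr

end Concentration

/-! ### Symmetric decreasing measures -/

section SymmDecreasing

variable {d : ℕ}

theorem SymmDecreasingFun.isCentered {f : EuclideanSpace ℝ (Fin d) → ℝ≥0∞}
    (hf : SymmDecreasingFun f) (r : ℝ≥0∞) : IsCentered {x | r < f x} :=
  fun v hv w hwv => lt_of_lt_of_le hv (hf.2 w v hwv)

theorem SymmDecreasingFun.measurable {f : EuclideanSpace ℝ (Fin d) → ℝ≥0∞}
    (hf : SymmDecreasingFun f) : Measurable f :=
  measurable_of_Ioi fun r => (hf.isCentered r).measurableSet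

/-- A bound for the modulus of absolute continuity of a symmetric decreasing measure in terms of the
distribution function of its density. -/
theorem modulus_le_of_eq_withDensity_add {ν : FiniteMeasure (EuclideanSpace ℝ (Fin d))}
    {f : EuclideanSpace ℝ (Fin d) → ℝ≥0∞} {c : ℝ≥0} (hf : SymmDecreasingFun f)
    (hν : (ν : Measure (EuclideanSpace ℝ (Fin d)))
      = volume.withDensity f + c • Measure.dirac 0) (α : ℝ≥0) :
    modulus ν α ≤ (∫⁻ r in Ioi (0 : ℝ), min α (volume {x | ENNReal.ofReal r < f x})) + c := by
  refine iSup_le fun A => iSup₂_le fun hA hAα => ?_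
  rw [hν, Measure.add_apply, withDensity_apply _ hA]
  refine add_le_add ?_ ?_
  · rw [lintegral_eq_lintegral_Ioi_measure_lt _ hf.measurable]
    refine lintegral_mono fun r => le_min ?_ (Measure.restrict_apply_le _ _)
    rw [← hAα, ← Measure.restrict_apply_univ A]
    exact measure_mono (subset_univ _)
  · rw [Measure.smul_apply, ENNReal.smul_def, smul_eq_mul]
    exact mul_le_of_le_one_right' prob_le_one

/-- Comparison of the integrals of the potentials of a set and of its rearrangement against a
measure and a symmetric decreasing measure that dominates it in concentration. -/
theorem lintegral_potential_le_of_lessConcentrated {φ : EuclideanSpace ℝ (Fin d) → ℝ≥0∞}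
    (hφ : Measurable φ) (hφr : ∀ v w, ‖w‖ ≤ ‖v‖ → φ v ≤ φ w) (hφi : ∫⁻ z, φ z ≠ ⊤)
    {K : ℝ} (hK : 0 ≤ K)
    (hφK : ∀ v w, φ v ≤ φ w + ENNReal.ofReal (K * (‖w‖ ^ 2 - ‖v‖ ^ 2)))
    {μ ν : FiniteMeasure (EuclideanSpace ℝ (Fin d))} (hν : SymmDecreasing ν)
    (hμν : LessConcentrated μ ν) {E D : Set (EuclideanSpace ℝ (Fin d))} (hE : MeasurableSet E)
    (hD : IsCentered D) (hDf : volume D ≠ ⊤) (hED : volume E ≤ volume D) :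
    ∫⁻ x, potential φ E x ∂(μ : Measure (EuclideanSpace ℝ (Fin d)))
      ≤ ∫⁻ x, potential φ D x ∂(ν : Measure (EuclideanSpace ℝ (Fin d))) := by
  obtain ⟨f, c, hf, hνf⟩ := hν
  have hm := measurable_potential hφ E
  have hmD := measurable_potential hφ D
  set G : ℝ → ℝ≥0∞ := fun s => volume {x | ENNReal.ofReal s < potential φ E x}
  set N : ℝ → ℝ≥0∞ := fun r => volume {x | ENNReal.ofReal r < f x}
  have hG : Measurable G := Antitone.measurable fun a b hab =>
    measure_mono fun x hx => (ENNReal.ofReal_le_ofReal hab).trans_lt hx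
  have hN : Measurable N := Antitone.measurable fun a b hab =>
    measure_mono fun x hx => (ENNReal.ofReal_le_ofReal hab).trans_lt hx
  have hGf : ∀ s ∈ Ioi (0 : ℝ), G s ≠ ⊤ := fun s hs => by
    refine measure_lt_ne_top_of_lintegral_ne_top hm ?_ (ENNReal.ofReal_pos.2 hs).ne'
      ENNReal.ofReal_ne_top
    rw [lintegral_potential hφ]
    exact ENNReal.mul_ne_top hφi (ne_top_of_le_ne_top hDf hED)
  have hNf : ∀ r ∈ Ioi (0 : ℝ), N r ≠ ⊤ := fun r hr => by
    refine measure_lt_ne_top_of_lintegral_ne_top hf.measurable ?_ (ENNReal.ofReal_pos.2 hr).ne'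
      ENNReal.ofReal_ne_top
    have h1 : (ν : Measure (EuclideanSpace ℝ (Fin d))) univ ≠ ⊤ := measure_ne_top _ _
    rw [hνf, Measure.add_apply, withDensity_apply _ MeasurableSet.univ, setLIntegral_univ] at h1
    exact (ENNReal.add_ne_top.1 h1).1
  -- the atom of `ν` contributes only to the levels below the maximum of the potential
  have hlevel : ∀ s ∈ Ioi (0 : ℝ),
      (μ : Measure (EuclideanSpace ℝ (Fin d))) {x | ENNReal.ofReal s < potential φ E x}
        ≤ (∫⁻ r in Ioi (0 : ℝ), min (G s) (N r))
          + {s : ℝ | ENNReal.ofReal s < potential φ D 0}.indicator (fun _ => (c : ℝ≥0∞)) s := by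
    intro s hs
    rcases eq_empty_or_nonempty {x | ENNReal.ofReal s < potential φ E x} with h0 | ⟨x, hx⟩
    · rw [h0, measure_empty]; exact zero_le
    · have hs' : s ∈ {s : ℝ | ENNReal.ofReal s < potential φ D 0} :=
        lt_of_lt_of_le hx (potential_le_potential_zero hφr hE hD hDf hED x)
      rw [indicator_of_mem hs']
      have e : ((G s).toNNReal : ℝ≥0∞) = G s := ENNReal.coe_toNNReal (hGf s hs)
      have h1 := (hμν (G s).toNNReal).trans (modulus_le_of_eq_withDensity_add hf hνf _)
      rw [e] at h1
      refine le_trans ?_ h1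
      exact le_iSup_of_le _ (le_iSup₂_of_le (measurableSet_lt measurable_const hm) e.symm le_rfl)
  have hmin : Measurable fun p : ℝ × ℝ => min (G p.1) (N p.2) :=
    (hG.comp measurable_fst).min (hN.comp measurable_snd)
  have hMs : MeasurableSet {s : ℝ | ENNReal.ofReal s < potential φ D 0} :=
    measurableSet_lt (by fun_prop) measurable_const
  calc ∫⁻ x, potential φ E x ∂(μ : Measure (EuclideanSpace ℝ (Fin d)))
      = ∫⁻ s in Ioi (0 : ℝ),
          (μ : Measure (EuclideanSpace ℝ (Fin d))) {x | ENNReal.ofReal s < potential φ E x} :=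
        lintegral_eq_lintegral_Ioi_measure_lt _ hm
    _ ≤ ∫⁻ s in Ioi (0 : ℝ), ((∫⁻ r in Ioi (0 : ℝ), min (G s) (N r))
          + {s : ℝ | ENNReal.ofReal s < potential φ D 0}.indicator (fun _ => (c : ℝ≥0∞)) s) :=
        setLIntegral_mono' measurableSet_Ioi hlevel
    _ = (∫⁻ s in Ioi (0 : ℝ), ∫⁻ r in Ioi (0 : ℝ), min (G s) (N r))
          + c * potential φ D 0 := by
        rw [lintegral_add_right _ (measurable_const.indicator hMs), lintegral_indicator hMs,
          setLIntegral_const, Measure.restrict_apply hMs, inter_comm, volume_Ioi_inter_ofReal_lt]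
    _ = (∫⁻ r in Ioi (0 : ℝ), ∫⁻ s in Ioi (0 : ℝ), min (G s) (N r))
          + c * potential φ D 0 := by
        rw [lintegral_lintegral_swap hmin.aemeasurable]
    _ ≤ (∫⁻ r in Ioi (0 : ℝ), ∫⁻ x in {x | ENNReal.ofReal r < f x}, potential φ D x)
          + c * potential φ D 0 := by
        gcongr ?_ + _
        exact setLIntegral_mono' measurableSet_Ioi fun r hr =>
          lintegral_min_volume_le hφ hφr hφi hK hφK hE hD hDf hED (hf.isCentered _) (hNf r hr)
    _ = (∫⁻ x, f x ∂volume.withDensity (potential φ D)) + c * potential φ D 0 := by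
        rw [lintegral_eq_lintegral_Ioi_measure_lt _ hf.measurable]
        simp_rw [withDensity_apply (potential φ D) ((hf.isCentered _).measurableSet)]
    _ = ∫⁻ x, potential φ D x ∂(ν : Measure (EuclideanSpace ℝ (Fin d))) := by
        rw [hνf, lintegral_add_measure, lintegral_smul_measure, lintegral_dirac,
          lintegral_withDensity_eq_lintegral_mul _ hmD hf.measurable,
          lintegral_withDensity_eq_lintegral_mul _ hf.measurable hmD, mul_comm f,
          ENNReal.smul_def, smul_eq_mul]

end SymmDecreasing

/-! ### The heat kernel -/

section Heat

variable {d : ℕ}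

theorem heatKernel_le_add {t : ℝ} (ht : 0 < t) (v w : EuclideanSpace ℝ (Fin d)) :
    ENNReal.ofReal (heatKernel d t v) ≤ ENNReal.ofReal (heatKernel d t w)
      + ENNReal.ofReal ((4 * Real.pi * t) ^ (-(d : ℝ) / 2) / (4 * t) * (‖w‖ ^ 2 - ‖v‖ ^ 2)) := by
  set A := (4 * Real.pi * t) ^ (-(d : ℝ) / 2)
  have hA : 0 ≤ A := by positivity
  rcases le_total (‖w‖ ^ 2) (‖v‖ ^ 2) with h | h
  · refine le_trans (ENNReal.ofReal_le_ofReal ?_) le_self_add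
    unfold heatKernel
    gcongr
  · rw [← ENNReal.ofReal_add (heatKernel_nonneg ht w)
      (mul_nonneg (by positivity) (by linarith))]
    refine ENNReal.ofReal_le_ofReal ?_
    set a := ‖v‖ ^ 2 / (4 * t)
    set b := ‖w‖ ^ 2 / (4 * t)
    have ha0 : 0 ≤ a := by positivity
    have hab : a ≤ b := by simp only [a, b]; gcongr
    have e1 : heatKernel d t v = A * Real.exp (-a) := by rw [heatKernel, neg_div (4 * t)]
    have e2 : heatKernel d t w = A * Real.exp (-b) := by rw [heatKernel, neg_div (4 * t)]
    have e3 : A / (4 * t) * (‖w‖ ^ 2 - ‖v‖ ^ 2) = A * (b - a) := by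
      simp only [a, b]; field_simp
    rw [e1, e2, e3, ← mul_add]
    refine mul_le_mul_of_nonneg_left ?_ hA
    have h1 : Real.exp (-b) = Real.exp (-a) * Real.exp (-(b - a)) := by
      rw [← Real.exp_add]; ring_nf
    have h2 : 1 - (b - a) ≤ Real.exp (-(b - a)) := by
      linarith [Real.add_one_le_exp (-(b - a))]
    have h3 : Real.exp (-a) ≤ 1 := Real.exp_le_one_iff.2 (by linarith)
    have h4 : Real.exp (-a) * (1 - (b - a)) ≤ Real.exp (-a) * Real.exp (-(b - a)) := by gcongr
    have h5 : Real.exp (-a) * (b - a) ≤ 1 * (b - a) := by gcongr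
    rw [h1]
    linarith

theorem heatKernel_radial {t : ℝ} (ht : 0 < t) (v w : EuclideanSpace ℝ (Fin d))
    (h : ‖w‖ ≤ ‖v‖) :
    ENNReal.ofReal (heatKernel d t v) ≤ ENNReal.ofReal (heatKernel d t w) := by
  refine ENNReal.ofReal_le_ofReal ?_
  unfold heatKernel
  gcongr

theorem heatSemigroup_apply_eq_lintegral_potential {t : ℝ} (ht : 0 < t)
    (μ : FiniteMeasure (EuclideanSpace ℝ (Fin d))) {E : Set (EuclideanSpace ℝ (Fin d))}
    (hE : MeasurableSet E) :
    (heatSemigroup t μ : Measure (EuclideanSpace ℝ (Fin d))) E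
      = ∫⁻ x, potential (fun z => ENNReal.ofReal (heatKernel d t z)) E x
        ∂(μ : Measure (EuclideanSpace ℝ (Fin d))) := by
  change ((μ : Measure (EuclideanSpace ℝ (Fin d))).conv (heatKernelMeasure d t)) E = _
  rw [← lintegral_indicator_one hE, Measure.lintegral_conv (measurable_one.indicator hE)]
  refine lintegral_congr fun x => ?_
  have hx : MeasurableSet ((fun y => x + y) ⁻¹' E) := (measurable_const_add x) hE
  calc ∫⁻ y, E.indicator 1 (x + y) ∂heatKernelMeasure d t
      = heatKernelMeasure d t ((fun y => x + y) ⁻¹' E) := by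
        rw [← lintegral_indicator_one hx]; rfl
    _ = ∫⁻ y in (fun y => x + y) ⁻¹' E, ENNReal.ofReal (heatKernel d t ((x + y) - x)) := by
        rw [heatKernelMeasure, if_pos ht, withDensity_apply _ hx]; simp
    _ = ∫⁻ z in E, ENNReal.ofReal (heatKernel d t (z - x)) :=
        (measurePreserving_add_left volume x).setLIntegral_comp_preimage_emb
          (measurableEmbedding_addLeft x) (fun z => ENNReal.ofReal (heatKernel d t (z - x))) E
    _ = _ := lintegral_congr fun z => by
        simp only [heatKernel, norm_sub_rev]

end Heat

end HeatConcentration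

/-- The heat semigroup preserves the order "less concentrated than" against symmetric decreasing
measures. -/
theorem mainTheorem3 (d : ℕ) (μ ν : MeasureTheory.FiniteMeasure (EuclideanSpace ℝ (Fin d)))
    (hν : HeatConcentration.SymmDecreasing ν) (hμν : HeatConcentration.LessConcentrated μ ν)
    (t : ℝ) (ht : 0 ≤ t) :
    HeatConcentration.LessConcentrated (HeatConcentration.heatSemigroup t μ)
      (HeatConcentration.heatSemigroup t ν) := by
  open HeatConcentration in
  rcases ht.eq_or_lt with rfl | ht
  · rwa [(isHeatSolution_heatSemigroup μ).initial, (isHeatSolution_heatSemigroup ν).initial]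
  refine fun α => iSup_le fun E => iSup₂_le fun hE hEα => ?_
  obtain ⟨D, hD, hDE⟩ := exists_isCentered_volume_eq (hEα ▸ ENNReal.coe_ne_top : volume E ≠ ⊤)
  have hDα : volume D = α := hDE.trans hEα
  refine le_iSup_of_le D (le_iSup₂_of_le hD.measurableSet hDα ?_)
  rw [heatSemigroup_apply_eq_lintegral_potential ht μ hE,
    heatSemigroup_apply_eq_lintegral_potential ht ν hD.measurableSet]
  exact lintegral_potential_le_of_lessConcentrated (measurable_heatKernel d t).ennreal_ofReal
    (heatKernel_radial ht)
    (integrable_heatKernel ht).lintegral_lt_top.ne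
    (by positivity : 0 ≤ (4 * Real.pi * t) ^ (-(d : ℝ) / 2) / (4 * t)) (heatKernel_le_add ht) hν hμν
    hE hD (hDα ▸ ENNReal.coe_ne_top) hDE.ge
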